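/- Let $X\in\mathbb R^{n\times d}$ have rank $r$, let $y\in\mathbb R^n$, $h:\mathbb R^d\to\mathbb R$, and write $\|u\|_X=\|Xu\|_2$. The Fréchet subdifferential $\tilde\partial f(x)$ of $f:\mathbb R^d\to\mathbb R$ is the set of all $u$ with $\liminf_{z\to x,\,z\ne x}\frac{f(z)-f(x)-\langle u,z-x\rangle}{\|z-x\|_2}\ge 0$. The limiting subdifferential $\partial f(x)$ is the set of limits of sequences $u_k\in\tilde\partial f(x_k)$ with $x_k\to x$ and $f(x_k)\to f(x)$. A point $x$ is critical for $f$ if $0\in\partial f(x)$. Let $\beta^*$ be any critical point of $f(\beta)=\frac12\|y-X\beta\|_2^2+h(\beta)$. For a sketching matrix $P\in\mathbb R^{m\times n}$, a run of $N$ iterations of Iterative SRO with the single sketch $P$ is a sequence $\beta^{(0)}=0,\beta^{(1)},\dots,\beta^{(N)}$ such that, for $1\le t\le N$, $\beta^{(t)}$ is a minimizer over $\mathbb R^d$ of $$\tfrac12\|PX(\beta-\beta^{(t-1)})\|_2^2-\langle y-X\beta^{(t-1)},X\beta\rangle+h(\beta).$$ Assume that one of the following holds: (a) $h$ is convex; put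 $c=0$; or (b) $X$ has full column rank and, for some $L_h\ge 0$, $\tilde\partial h$ is $L_h$-smooth, i.e. $\|u-v\|_2\le L_h\|x-z\|_2$ for all $x,z\in\mathbb R^d$, $u\in\tilde\partial h(x)$, $v\in\tilde\partial h(z)$; put $c=L_h/\sigma_{\min}^2(X)$. Let $0<\delta<1$ and $\rho>0$, and consider the following property of a random matrix $P$: (G) with probability at least $1-\delta$ over $P$, for every $N\ge 0$ and every run of $N$ iterations of Iterative SRO with sketch $P$, $$\|\beta^{(N)}-\beta^*\|_X\le\rho^N\|\beta^*\|_X .$$ Then: 1. (General embeddings.) Let $0<\varepsilon<1$, $c<1-\varepsilon$, and $\frac{\varepsilon}{1-\varepsilon-c}\le\rho$ (equivalently $\varepsilon\le(1-c)\frac{\rho}{\rho+1}$; in the convex case $\varepsilon\le\frac{\rho}{\rho+1}$). If $P$ is drawn from an $(\varepsilon,\delta)$ oblivious $\ell^2$-subspace embedding, i.e. a distribution over $m\times n$ matrices such that for each fixed $Z\in\mathbb R^{n\times d}$, with probability at least $1-\delta$, $(1-\varepsilon)\|Z\beta\|_2^2\le\|PZ\beta\|_2^2\le(1+\varepsilon)\|Z\beta\|_2^2$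 for all $\beta\in\mathbb R^d$, then (G) holds. In particular the error contracts geometrically when $\rho$ can be taken in $(0,1)$. 2. (Sketch size.) There is a universal constant $C>0$, not depending on any of the quantities above, such that, if $0<\rho<1$ and $c<1$, (G) holds - for the Gaussian embedding $P=P'/\sqrt m$, where $P'\in\mathbb R^{m\times n}$ has i.i.d. $\mathcal N(0,1)$ entries, whenever $$m\ge \frac{C}{(1-c)^2}\Bigl(r+\log\frac1\delta\Bigr)\frac{(\rho+1)^2}{\rho^2};$$ - for the sparse embedding $P\in\mathbb R^{m\times n}$ with $m\ge1$, where independently in each column $i$ the only nonzero entry is a uniformly random sign in a uniformly random row, whenever $$m\ge \frac{C}{(1-c)^2}\cdot\frac{r^2}{\delta}\cdot\frac{(\rho+1)^2}{\rho^2}.$$ In the convex case $c=0$, so the sketch sizes are $O\bigl((r+\log\frac1\delta)(\rho+1)^2/\rho^2\bigr)$ and $O\bigl(\frac{r^2}{\delta}(\rho+1)^2/\rho^2\bigr)$ with a universal constant; in case (b) the constant depends on $L_h/\sigma_{\min}^2(X)$ only. -/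

import Mathlib

open MeasureTheory ProbabilityTheory Filter Topology

noncomputable section

namespace SRO

/-- `ℝᵈ` with the Euclidean norm. -/
abbrev Vec (d : ℕ) : Type := EuclideanSpace ℝ (Fin d)

/-- Real `m × n` matrices. -/
abbrev Mat (m n : ℕ) : Type := Matrix (Fin m) (Fin n) ℝ

/-- The product (equivalently Borel) sigma-algebra on matrices, entry by entry. -/
instance instMeasurableSpaceMat (m n : ℕ) : MeasurableSpace (Mat m n) :=
  inferInstanceAs (MeasurableSpace (Fin m → Fin n → ℝ))

/-- The matrix-vector product `A u`, as a vector of Euclidean space. -/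
abbrev act {m n : ℕ} (A : Mat m n) (u : Vec n) : Vec m := Matrix.toEuclideanLin A u

/-- The semi-norm `‖u‖_X = ‖X u‖₂`. -/
def seminormX {n d : ℕ} (X : Mat n d) (u : Vec d) : ℝ := ‖act X u‖

/-- The smallest singular value of an `n × d` matrix of full column rank, that is, its `d`-th
largest one (Mathlib numbers singular values from `0`, in decreasing order). -/
def sigmaMin {n d : ℕ} (X : Mat n d) : ℝ :=
  (Matrix.toEuclideanLin X).singularValues (d - 1)

/-! ### Subdifferentials and critical points -/

/-- The Frechet subdifferential of `f` at `x`. The lower limit is taken in the extended reals. -/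
def frechetSubdiff {d : ℕ} (f : Vec d → ℝ) (x : Vec d) : Set (Vec d) :=
  {u | (0 : EReal) ≤
    liminf (fun y => (((f y - f x - inner ℝ u (y - x)) / ‖y - x‖ : ℝ) : EReal)) (𝓝[≠] x)}

/-- The limiting subdifferential of `f` at `x`. -/
def limitingSubdiff {d : ℕ} (f : Vec d → ℝ) (x : Vec d) : Set (Vec d) :=
  {u | ∃ xs us : ℕ → Vec d,
    Tendsto xs atTop (𝓝 x) ∧ Tendsto (fun k => f (xs k)) atTop (𝓝 (f x)) ∧
    (∀ k, us k ∈ frechetSubdiff f (xs k)) ∧ Tendsto us atTop (𝓝 u)}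

/-- `x` is a critical point of `f`. -/
def IsCriticalPoint {d : ℕ} (f : Vec d → ℝ) (x : Vec d) : Prop :=
  (0 : Vec d) ∈ limitingSubdiff f x

/-- The Frechet subdifferential of `h` is `L`-smooth. -/
def FrechetSmooth {d : ℕ} (h : Vec d → ℝ) (L : ℝ) : Prop :=
  ∀ x y : Vec d, ∀ u ∈ frechetSubdiff h x, ∀ v ∈ frechetSubdiff h y, ‖u - v‖ ≤ L * ‖x - y‖

/-! ### The regularized least square problem and Iterative SRO -/

/-- The objective `½ ‖y - X β‖² + h β` of the original problem. -/
def objective {n d : ℕ} (X : Mat n d) (y : Vec n) (h : Vec d → ℝ) (β : Vec d) : ℝ :=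
  1 / 2 * ‖y - act X β‖ ^ 2 + h β

/-- The sketched objective minimized in one step of Iterative SRO from the previous iterate `b`:
`½ ‖(P X) (β - b)‖² - ⟨y - X b, X β⟩ + h β`. -/
def stepObjective {m n d : ℕ} (P : Mat m n) (X : Mat n d) (y : Vec n) (h : Vec d → ℝ)
    (b β : Vec d) : ℝ :=
  1 / 2 * ‖act (P * X) (β - b)‖ ^ 2 - inner ℝ (y - act X b) (act X β) + h β

/-- `β 0, …, β N` are the iterates of a run of `N` iterations of Iterative SRO, all of them with the
same sketching matrix `P`; the output of the run is `β N`. -/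
def IsIterativeSRO {m n d : ℕ} (P : Mat m n) (X : Mat n d) (y : Vec n) (h : Vec d → ℝ)
    (N : ℕ) (β : ℕ → Vec d) : Prop :=
  β 0 = 0 ∧ ∀ t < N, IsMinOn (stepObjective P X y h (β t)) Set.univ (β (t + 1))

/-! ### Random sketching matrices -/

/-- With probability at least `p`, a random matrix `P` with law `μ` has the property `Q`: the
property holds on a measurable event of probability at least `p`. -/
def WithProbAtLeast {m n : ℕ} (μ : Measure (Mat m n)) (p : ℝ) (Q : Mat m n → Prop) : Prop :=
  ∃ A : Set (Mat m n), MeasurableSet A ∧ ENNReal.ofReal p ≤ μ A ∧ ∀ P ∈ A, Q P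

/-- `P` is a `(1 ± ε)` `ℓ²`-subspace embedding for `X`. -/
def IsSubspaceEmbedding {m n d : ℕ} (ε : ℝ) (X : Mat n d) (P : Mat m n) : Prop :=
  ∀ β : Vec d, (1 - ε) * ‖act X β‖ ^ 2 ≤ ‖act P (act X β)‖ ^ 2 ∧
    ‖act P (act X β)‖ ^ 2 ≤ (1 + ε) * ‖act X β‖ ^ 2

/-- The distribution `μ` over `m × n` matrices is an `(ε, δ)` oblivious `ℓ²`-subspace embedding
(for matrices with `d` columns). -/
def IsObliviousSubspaceEmbedding {m n : ℕ} (d : ℕ) (ε δ : ℝ) (μ : Measure (Mat m n)) : Prop :=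
  IsProbabilityMeasure μ ∧
    ∀ X : Mat n d, WithProbAtLeast μ (1 - δ) (IsSubspaceEmbedding ε X)

/-- The law of the Gaussian sketch `P' / √m`, with i.i.d. standard Gaussian entries in `P'`. -/
def gaussianSketch (m n : ℕ) : Measure (Mat m n) :=
  (Measure.pi fun _ : Fin m => Measure.pi fun _ : Fin n => gaussianReal 0 1).map
    fun A => Matrix.of fun j i => A j i / √(m : ℝ)

/-- The matrix whose `i`-th column has the single nonzero entry `σᵢ ∈ {1, -1}`, in row `hᵢ`, where
`w i = (hᵢ, σᵢ)`. -/
def sparseMatrix {m n : ℕ} (w : Fin n → Fin m × ℤˣ) : Mat m n :=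
  Matrix.of fun j i => if j = (w i).1 then (((w i).2 : ℤ) : ℝ) else 0

/-- The law of the sparse sketch: independently for each column, the row of the nonzero entry is
uniform and its sign is uniform. -/
def sparseSketch (m n : ℕ) : Measure (Mat m n) :=
  (Measure.pi fun _ : Fin n =>
    (uniformOn (Set.univ : Set (Fin m))).prod (uniformOn (Set.univ : Set ℤˣ))).map sparseMatrix

/-! ### The two regimes and the geometric bound -/

/-- The regularizer `h` is convex, with modulus `c = 0`; or its Frechet subdifferential is
`L`-smooth and `X` has full column rank, with modulus `c = L / σ_min(X)²`. -/
def Regime {n d : ℕ} (X : Mat n d) (h : Vec d → ℝ) (c : ℝ) : Prop :=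
  (ConvexOn ℝ Set.univ h ∧ c = 0) ∨
    ∃ L : ℝ, 0 ≤ L ∧ FrechetSmooth h L ∧ X.rank = d ∧ c = L / sigmaMin X ^ 2

/-- For a sketching matrix `P` drawn from `μ`, with probability at least `1 - δ`, every run of
Iterative SRO with `P`, of any number `N` of iterations, has an output with
`‖β_N - β*‖_X ≤ ρ ^ N ‖β*‖_X`. -/
def GeometricBound {m n d : ℕ} (μ : Measure (Mat m n)) (X : Mat n d) (y : Vec n)
    (h : Vec d → ℝ) (βstar : Vec d) (δ ρ : ℝ) : Prop :=
  WithProbAtLeast μ (1 - δ) fun P =>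
    ∀ (N : ℕ) (β : ℕ → Vec d), IsIterativeSRO P X y h N β →
      seminormX X (β N - βstar) ≤ ρ ^ N * seminormX X βstar

end SRO

end

namespace SRO

/-! ### Frechet subgradients -/

/-! Write `e` for the error of the new iterate and `e'` for that of the previous one. Fermat's rule
gives a Fréchet subgradient of `h` at the new iterate; criticality of `βstar` gives subgradients of
`h` at points tending to `βstar`. In both regimes the subdifferential of `h` is monotone up to
`-c‖Xe‖²`. Comparing the two and passing to the limit (`step_inequality`) yields `‖PXe‖² - c‖Xe‖² ≤
⟨PXe', PXe⟩ - ⟨Xe', Xe⟩`. If `P` distorts squared norms on the column space of `X` by at most `ε`,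
polarization bounds the right side by `ε‖Xe'‖‖Xe‖`, and the left side is at least `(1 - ε -
c)‖Xe‖²`. Each step thus contracts by `ε / (1 - ε - c) ≤ ρ` (`step_contraction`). The only random
event is that `P` embeds this one column space, so it serves all runs and all `N` at once.

For the sketch sizes, take `ε = (1 - c)ρ/(ρ + 1)` and embed a space of dimension `r = X.rank`.
Gaussian case: chi-square concentration and a union bound over a net
(`gaussianSketch_isSubspaceEmbedding`). Sparse case: a second moment bound on the Frobenius norm of
the Gram distortion in an orthonormal basis, then Markov (`sparseSketch_isSubspaceEmbedding`). -/

lemma mem_frechetSubdiff_iff {d : ℕ} {f : Vec d → ℝ} {x u : Vec d} :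
    u ∈ frechetSubdiff f x ↔
      ∀ ε : ℝ, 0 < ε → ∀ᶠ y in 𝓝 x, f x + inner ℝ u (y - x) - ε * ‖y - x‖ ≤ f y := by
  constructor
  · intro hu ε hε
    have h1 : ((-ε : ℝ) : EReal) <
        liminf (fun y => (((f y - f x - inner ℝ u (y - x)) / ‖y - x‖ : ℝ) : EReal)) (𝓝[≠] x) :=
      lt_of_lt_of_le (by exact_mod_cast (neg_lt_zero.mpr hε)) hu
    have h2 := eventually_lt_of_lt_liminf h1
    rw [eventually_nhdsWithin_iff] at h2
    filter_upwards [h2] with y hy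
    by_cases hxy : y = x
    · simp [hxy]
    · have h3 := hy hxy
      have h4 : -ε < (f y - f x - inner ℝ u (y - x)) / ‖y - x‖ := by exact_mod_cast h3
      have h5 : 0 < ‖y - x‖ := norm_pos_iff.mpr (sub_ne_zero.mpr hxy)
      rw [lt_div_iff₀ h5] at h4
      linarith
  · intro hu
    show (0 : EReal) ≤ _
    refine le_of_forall_lt fun a ha => ?_
    obtain ⟨b, hab, hb⟩ := EReal.lt_iff_exists_real_btwn.mp ha
    have hb' : b < 0 := by exact_mod_cast hb
    refine lt_of_lt_of_le hab (le_liminf_of_le (by isBoundedDefault) ?_)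
    have h1 := hu (-b) (by linarith)
    filter_upwards [nhdsWithin_le_nhds h1, self_mem_nhdsWithin] with y hy hxy
    have h5 : 0 < ‖y - x‖ := norm_pos_iff.mpr (sub_ne_zero.mpr hxy)
    have : b ≤ (f y - f x - inner ℝ u (y - x)) / ‖y - x‖ := by
      rw [le_div_iff₀ h5]; linarith
    exact_mod_cast this

/-- Subtracting a function with gradient `g` and quadratic remainder shifts Frechet subgradients. -/
lemma sub_mem_frechetSubdiff {d : ℕ} {f h : Vec d → ℝ} {x u g : Vec d} (K : ℝ)
    (hu : u ∈ frechetSubdiff f x)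
    (hq : ∀ y, f y - f x - (h y - h x) ≤ inner ℝ g (y - x) + K * ‖y - x‖ ^ 2) :
    u - g ∈ frechetSubdiff h x := by
  rw [mem_frechetSubdiff_iff] at hu ⊢
  intro ε hε
  have h1 : ∀ᶠ y in 𝓝 x, K * ‖y - x‖ < ε / 2 := by
    have : Tendsto (fun y => K * ‖y - x‖) (𝓝 x) (𝓝 (K * ‖x - x‖)) :=
      (by fun_prop : Continuous fun y => K * ‖y - x‖).tendsto x
    rw [sub_self, norm_zero, mul_zero] at this
    exact this.eventually_lt_const (by linarith)
  filter_upwards [hu (ε / 2) (by linarith), h1] with y hy hK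
  have h2 := hq y
  have h3 : K * ‖y - x‖ ^ 2 ≤ ε / 2 * ‖y - x‖ := by
    rw [pow_two, ← mul_assoc]
    exact mul_le_mul_of_nonneg_right hK.le (norm_nonneg _)
  rw [inner_sub_left]
  linarith

lemma IsMinOn.zero_mem_frechetSubdiff {d : ℕ} {f : Vec d → ℝ} {x : Vec d}
    (hx : IsMinOn f Set.univ x) : (0 : Vec d) ∈ frechetSubdiff f x := by
  rw [mem_frechetSubdiff_iff]
  intro ε hε
  refine Eventually.of_forall fun y => ?_
  have h1 : f x ≤ f y := hx (Set.mem_univ y)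
  have h2 : 0 ≤ ε * ‖y - x‖ := by positivity
  rw [inner_zero_left]
  linarith

/-- The local inequality at `x + s(y - x)` becomes global because convexity bounds `h` there by the
chord; dividing by the small `s > 0` leaves an error `η‖y - x‖ ≤ ε`. -/
lemma ConvexOn.le_of_mem_frechetSubdiff {d : ℕ} {h : Vec d → ℝ} (hh : ConvexOn ℝ Set.univ h)
    {x u : Vec d} (hu : u ∈ frechetSubdiff h x) (y : Vec d) :
    h x + inner ℝ u (y - x) ≤ h y := by
  rw [mem_frechetSubdiff_iff] at hu
  refine le_of_forall_pos_le_add fun ε hε => ?_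
  set η := ε / (‖y - x‖ + 1)
  have hη : 0 < η := by positivity
  have hηε : η * ‖y - x‖ ≤ ε := by
    rw [div_mul_eq_mul_div, div_le_iff₀ (by positivity)]
    nlinarith [norm_nonneg (y - x)]
  have h1 : Tendsto (fun s : ℝ => x + s • (y - x)) (𝓝[>] 0) (𝓝 x) := by
    have : Tendsto (fun s : ℝ => x + s • (y - x)) (𝓝 0) (𝓝 (x + (0 : ℝ) • (y - x))) :=
      (by fun_prop : Continuous fun s : ℝ => x + s • (y - x)).tendsto 0
    rw [zero_smul, add_zero] at this
    exact this.mono_left nhdsWithin_le_nhds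
  have h2 := h1.eventually (hu η hη)
  have h3 : ∀ᶠ s : ℝ in 𝓝[>] 0, s ≤ 1 :=
    nhdsWithin_le_nhds (eventually_le_nhds (by norm_num))
  obtain ⟨s, hs, hs1, hs0⟩ := (h2.and (h3.and self_mem_nhdsWithin)).exists
  have hs0 : 0 < s := hs0
  have h4 := hh.2 (Set.mem_univ x) (Set.mem_univ y) (sub_nonneg.mpr hs1) hs0.le (by ring)
  have h5 : (1 - s) • x + s • y = x + s • (y - x) := by module
  rw [h5] at h4
  rw [add_sub_cancel_left, inner_smul_right, norm_smul, Real.norm_of_nonneg hs0.le] at hs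
  simp only [smul_eq_mul] at h4
  have h6 : s * (h x + inner ℝ u (y - x)) ≤ s * (h y + ε) := by nlinarith
  exact le_of_mul_le_mul_left h6 hs0

lemma ConvexOn.inner_frechetSubdiff_nonneg {d : ℕ} {h : Vec d → ℝ}
    (hh : ConvexOn ℝ Set.univ h) {x y u v : Vec d} (hu : u ∈ frechetSubdiff h x)
    (hv : v ∈ frechetSubdiff h y) : 0 ≤ inner ℝ (u - v) (x - y) := by
  have h1 := ConvexOn.le_of_mem_frechetSubdiff hh hu y
  have h2 := ConvexOn.le_of_mem_frechetSubdiff hh hv x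
  have h3 : inner ℝ u (y - x) = - inner ℝ u (x - y) := by rw [← inner_neg_right, neg_sub]
  rw [inner_sub_left]
  linarith

/-! ### The smallest singular value -/

lemma sigmaMin_sq_mul_le {n d : ℕ} (X : Mat n d) (u : Vec d) :
    sigmaMin X ^ 2 * ‖u‖ ^ 2 ≤ ‖act X u‖ ^ 2 := by
  -- For `d = 0` the index `d - 1` in `sigmaMin` truncates to `0`, but every vector vanishes.
  rcases Nat.eq_zero_or_pos d with rfl | hd
  · have : u = 0 := Subsingleton.elim _ _
    simp [this]
  set T := Matrix.toEuclideanLin X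
  have hfin : Module.finrank ℝ (Vec d) = d := by simp
  have hsym := T.isPositive_adjoint_comp_self.isSymmetric
  set b := hsym.eigenvectorBasis hfin
  have h1 : ‖act X u‖ ^ 2 = inner ℝ ((LinearMap.adjoint T ∘ₗ T) u) u := by
    rw [LinearMap.comp_apply, LinearMap.adjoint_inner_left, real_inner_self_eq_norm_sq]
  rw [h1, ← OrthonormalBasis.sum_inner_mul_inner b, ← b.sum_sq_norm_inner_right u, Finset.mul_sum]
  refine Finset.sum_le_sum fun i _ => ?_
  have h2 : inner ℝ ((LinearMap.adjoint T ∘ₗ T) u) (b i)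
      = hsym.eigenvalues hfin i * inner ℝ u (b i) := by
    rw [hsym u (b i)]
    have := hsym.apply_eigenvectorBasis hfin i
    rw [this, inner_smul_right]
    rfl
  have h3 : sigmaMin X ^ 2 ≤ hsym.eigenvalues hfin i := by
    have h4 := T.sq_singularValues_fin hfin i
    have h5 : sigmaMin X ≤ T.singularValues i :=
      T.singularValues_antitone (by omega)
    have h6 : 0 ≤ sigmaMin X := T.singularValues_nonneg _
    calc sigmaMin X ^ 2 ≤ T.singularValues i ^ 2 := by gcongr
      _ = _ := by exact_mod_cast h4
  rw [h2, Real.norm_eq_abs, sq_abs, real_inner_comm (b i) u, pow_two (inner ℝ (b i) u), mul_assoc]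
  exact mul_le_mul_of_nonneg_right h3 (mul_self_nonneg _)

lemma finrank_range_toEuclideanLin {n d : ℕ} (X : Mat n d) :
    Module.finrank ℝ (Matrix.toEuclideanLin X).range = X.rank := by
  rw [Matrix.rank_eq_finrank_range_toLin X (EuclideanSpace.basisFun _ ℝ).toBasis
    (EuclideanSpace.basisFun _ ℝ).toBasis, Matrix.toEuclideanLin_eq_toLin_orthonormal]

lemma sigmaMin_pos {n d : ℕ} {X : Mat n d} (hX : X.rank = d) (hd : 0 < d) : 0 < sigmaMin X := by
  unfold sigmaMin
  rw [LinearMap.singularValues_pos_iff_lt_finrank_range]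
  have := finrank_range_toEuclideanLin X
  omega

lemma Regime.nonneg {n d : ℕ} {X : Mat n d} {h : Vec d → ℝ} {c : ℝ} (hc : Regime X h c) :
    0 ≤ c := by
  rcases hc with ⟨-, rfl⟩ | ⟨L, hL, -, -, rfl⟩
  · exact le_rfl
  · positivity

/-- Both regimes make the Frechet subdifferential weakly monotone for `‖·‖_X`, with modulus `c`. -/
lemma Regime.le_inner {n d : ℕ} {X : Mat n d} {h : Vec d → ℝ} {c : ℝ} (hc : Regime X h c)
    {x y u v : Vec d} (hu : u ∈ frechetSubdiff h x) (hv : v ∈ frechetSubdiff h y) :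
    -(c * ‖act X (x - y)‖ ^ 2) ≤ inner ℝ (u - v) (x - y) := by
  rcases hc with ⟨hconv, rfl⟩ | ⟨L, hL, hsm, hX, rfl⟩
  · simpa using ConvexOn.inner_frechetSubdiff_nonneg hconv hu hv
  rcases Nat.eq_zero_or_pos d with rfl | hd
  · have : x - y = 0 := Subsingleton.elim _ _
    simp [this]
  have h1 := hsm x y u hu v hv
  have h2 : ‖u - v‖ * ‖x - y‖ ≤ L * ‖x - y‖ * ‖x - y‖ := by gcongr
  have h3 := neg_le_of_abs_le (abs_real_inner_le_norm (u - v) (x - y))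
  have h4 := sigmaMin_sq_mul_le X (x - y)
  have h5 : 0 < sigmaMin X ^ 2 := pow_pos (sigmaMin_pos hX hd) 2
  have h6 : L * ‖x - y‖ ^ 2 ≤ L / sigmaMin X ^ 2 * ‖act X (x - y)‖ ^ 2 := by
    rw [div_mul_eq_mul_div, le_div_iff₀ h5]
    nlinarith
  nlinarith

/-! ### One step of Iterative SRO -/

lemma norm_sub_sq_quadratic {d : ℕ} {E : Type*} [NormedAddCommGroup E] [InnerProductSpace ℝ E]
    (T : Vec d →ₗ[ℝ] E) (b x y : Vec d) :
    1 / 2 * ‖T (y - b)‖ ^ 2 - 1 / 2 * ‖T (x - b)‖ ^ 2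
      = inner ℝ (T (x - b)) (T (y - x)) + 1 / 2 * ‖T (y - x)‖ ^ 2 := by
  have : T (y - b) = T (x - b) + T (y - x) := by rw [← map_add]; congr 1; abel
  rw [this, norm_add_sq_real]
  ring

lemma exists_norm_sq_le {d : ℕ} {E : Type*} [NormedAddCommGroup E] [NormedSpace ℝ E]
    (T : Vec d →ₗ[ℝ] E) : ∃ K : ℝ, ∀ u, 1 / 2 * ‖T u‖ ^ 2 ≤ K * ‖u‖ ^ 2 := by
  refine ⟨1 / 2 * ‖LinearMap.toContinuousLinearMap T‖ ^ 2, fun u => ?_⟩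
  have := (LinearMap.toContinuousLinearMap T).le_opNorm u
  simp only [LinearMap.coe_toContinuousLinearMap'] at this
  calc 1 / 2 * ‖T u‖ ^ 2 ≤ 1 / 2 * (‖LinearMap.toContinuousLinearMap T‖ * ‖u‖) ^ 2 := by gcongr
    _ = _ := by ring

lemma act_mul {m n d : ℕ} (P : Mat m n) (X : Mat n d) (u : Vec d) :
    act (P * X) u = act P (act X u) := by
  simp [act, Matrix.toLpLin_apply, Matrix.mulVec_mulVec]

/-- Fermat's rule: `0` is a subgradient of the step objective, and its quadratic and linear parts
are removed by subtracting their gradient. -/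
lemma step_mem_frechetSubdiff {m n d : ℕ} {P : Mat m n} {X : Mat n d} {y : Vec n}
    {h : Vec d → ℝ} {b β : Vec d} (hβ : IsMinOn (stepObjective P X y h b) Set.univ β) :
    LinearMap.adjoint (Matrix.toEuclideanLin X) (y - act X b)
      - LinearMap.adjoint (Matrix.toEuclideanLin (P * X)) (act (P * X) (β - b))
      ∈ frechetSubdiff h β := by
  obtain ⟨K, hK⟩ := exists_norm_sq_le (Matrix.toEuclideanLin (P * X))
  have := sub_mem_frechetSubdiff (h := h)
    (g := LinearMap.adjoint (Matrix.toEuclideanLin (P * X)) (act (P * X) (β - b))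
      - LinearMap.adjoint (Matrix.toEuclideanLin X) (y - act X b)) K
    (IsMinOn.zero_mem_frechetSubdiff hβ) fun z => ?_
  · rwa [zero_sub, neg_sub] at this
  · have h1 := norm_sub_sq_quadratic (Matrix.toEuclideanLin (P * X)) b β z
    have h2 := hK (z - β)
    rw [inner_sub_left, LinearMap.adjoint_inner_left, LinearMap.adjoint_inner_left]
    unfold stepObjective
    have h3 : inner ℝ (y - act X b) (act X (z - β))
      = inner ℝ (y - act X b) (act X z) - inner ℝ (y - act X b) (act X β) := by
      simp only [act, map_sub, inner_sub_right]
    simp only [act] at *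
    linarith

/-- Needed at an arbitrary point `x`, since criticality only provides Fréchet subgradients along a
sequence tending to `βstar`. -/
lemma objective_sub_mem_frechetSubdiff {n d : ℕ} {X : Mat n d} {y : Vec n}
    {h : Vec d → ℝ} {x u : Vec d} (hu : u ∈ frechetSubdiff (objective X y h) x) :
    u + LinearMap.adjoint (Matrix.toEuclideanLin X) (y - act X x) ∈ frechetSubdiff h x := by
  obtain ⟨K, hK⟩ := exists_norm_sq_le (Matrix.toEuclideanLin X)
  have := sub_mem_frechetSubdiff (h := h)
    (g := - LinearMap.adjoint (Matrix.toEuclideanLin X) (y - act X x)) K hu fun z => ?_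
  · rwa [sub_neg_eq_add] at this
  · have h2 := hK (z - x)
    rw [inner_neg_left, LinearMap.adjoint_inner_left]
    have h3 : y - act X z = (y - act X x) - act X (z - x) := by
      simp [act, map_sub]
    unfold objective
    rw [h3, norm_sub_sq_real]
    simp only [act] at *
    linarith

lemma step_inequality {m n d : ℕ} {P : Mat m n} {X : Mat n d} {y : Vec n} {h : Vec d → ℝ}
    {c : ℝ} {b β βstar : Vec d} (hc : Regime X h c)
    (hstar : IsCriticalPoint (objective X y h) βstar)
    (hβ : IsMinOn (stepObjective P X y h b) Set.univ β) :
    -(c * ‖act X (β - βstar)‖ ^ 2) ≤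
      - inner ℝ (act X (b - βstar)) (act X (β - βstar))
      - inner ℝ (act P (act X (β - b))) (act P (act X (β - βstar))) := by
  obtain ⟨xs, us, hxs, -, hus, hu0⟩ := hstar
  have h1 := step_mem_frechetSubdiff hβ
  set w := LinearMap.adjoint (Matrix.toEuclideanLin X) (y - act X b)
      - LinearMap.adjoint (Matrix.toEuclideanLin (P * X)) (act (P * X) (β - b)) with hw
  have h2 : ∀ k, -(c * ‖act X (β - xs k)‖ ^ 2) ≤
      inner ℝ (w - (us k + LinearMap.adjoint (Matrix.toEuclideanLin X) (y - act X (xs k))))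
        (β - xs k) := fun k => hc.le_inner h1 (objective_sub_mem_frechetSubdiff (hus k))
  have hX : Continuous fun u => act X u := (Matrix.toEuclideanLin X).continuous_of_finiteDimensional
  have hXa : Continuous (LinearMap.adjoint (Matrix.toEuclideanLin X)) :=
    (LinearMap.adjoint (Matrix.toEuclideanLin X)).continuous_of_finiteDimensional
  -- Joint continuity in point and subgradient carries the inequality to `(βstar, 0)`, so no
  -- subgradient of `h` at `βstar` itself is required.
  have hF : Continuous fun p : Vec d × Vec d =>
      inner ℝ (w - (p.2 + LinearMap.adjoint (Matrix.toEuclideanLin X) (y - act X p.1)))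
        (β - p.1) + c * ‖act X (β - p.1)‖ ^ 2 := by fun_prop
  have h3 := (hF.tendsto (βstar, 0)).comp (hxs.prodMk_nhds hu0)
  have h4 := ge_of_tendsto' h3 (b := 0) fun k => by
    have := h2 k
    simp only [Function.comp_apply]
    linarith
  simp only [zero_add] at h4
  have h5 : inner ℝ (w - LinearMap.adjoint (Matrix.toEuclideanLin X) (y - act X βstar))
      (β - βstar) = - inner ℝ (act X (b - βstar)) (act X (β - βstar))
      - inner ℝ (act P (act X (β - b))) (act P (act X (β - βstar))) := by
    rw [hw, ← act_mul, ← act_mul]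
    simp only [inner_sub_left, LinearMap.adjoint_inner_left, act, map_sub]
    ring
  linarith

/-- A linear map that distorts squared norms by a factor in `[1 - ε, 1 + ε]` distorts inner
products accordingly. -/
lemma abs_inner_map_sub_inner_le {E F : Type*} [NormedAddCommGroup E] [InnerProductSpace ℝ E]
    [NormedAddCommGroup F] [InnerProductSpace ℝ F] {T : E →ₗ[ℝ] F} {ε : ℝ}
    (hT : ∀ v, |‖T v‖ ^ 2 - ‖v‖ ^ 2| ≤ ε * ‖v‖ ^ 2) (a b : E) :
    |inner ℝ (T a) (T b) - inner ℝ a b| ≤ ε * (‖a‖ * ‖b‖) := by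
  -- Polarization gives the mean of the squared norms; normalizing both vectors then turns this mean
  -- into the product of the norms.
  have key : ∀ a b : E,
      |inner ℝ (T a) (T b) - inner ℝ a b| ≤ ε * ((‖a‖ ^ 2 + ‖b‖ ^ 2) / 2) := by
    intro a b
    obtain ⟨h1, h2⟩ := abs_le.mp (hT (a + b))
    obtain ⟨h3, h4⟩ := abs_le.mp (hT (a - b))
    rw [map_add, norm_add_sq_real, norm_add_sq_real] at h1 h2
    rw [map_sub, norm_sub_sq_real, norm_sub_sq_real] at h3 h4
    rw [abs_le]
    constructor <;> linarith
  rcases eq_or_ne a 0 with rfl | ha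
  · simp
  rcases eq_or_ne b 0 with rfl | hb
  · simp
  have h0 := norm_pos_iff.mpr ha
  have h0' := norm_pos_iff.mpr hb
  have h1 := key (‖a‖⁻¹ • a) (‖b‖⁻¹ • b)
  rw [map_smul, map_smul, inner_smul_left, inner_smul_left, inner_smul_right, inner_smul_right,
    norm_smul, norm_smul, norm_inv, norm_inv, norm_norm, norm_norm, inv_mul_cancel₀ h0.ne',
    inv_mul_cancel₀ h0'.ne', ← mul_sub, ← mul_sub, abs_mul, abs_mul] at h1
  simp only [conj_trivial, abs_inv, abs_norm] at h1
  rw [inv_mul_le_iff₀ h0, inv_mul_le_iff₀ h0'] at h1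
  linarith

/-- The action of a matrix on the column space of another one. -/
noncomputable def rangeAct {m n d : ℕ} (X : Mat n d) (P : Mat m n) :
    (Matrix.toEuclideanLin X).range →ₗ[ℝ] Vec m :=
  (Matrix.toEuclideanLin P).domRestrict _

/-- Moving to the column space makes the dimension in the net and basis arguments equal to `X.rank`,
rather than `n` or `d`. -/
lemma isSubspaceEmbedding_iff {m n d : ℕ} {ε : ℝ} {X : Mat n d} {P : Mat m n} :
    IsSubspaceEmbedding ε X P ↔ ∀ v, |‖rangeAct X P v‖ ^ 2 - ‖v‖ ^ 2| ≤ ε * ‖v‖ ^ 2 := by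
  have h : ∀ a b : ℝ, (1 - ε) * b ≤ a ∧ a ≤ (1 + ε) * b ↔ |a - b| ≤ ε * b := fun a b => by
    rw [abs_le]
    constructor <;> rintro ⟨h1, h2⟩ <;> constructor <;> linarith
  constructor
  · rintro hP ⟨_, β, rfl⟩
    exact (h _ _).mp (hP β)
  · intro hP β
    exact (h _ _).mpr (hP ⟨_, β, rfl⟩)

lemma IsSubspaceEmbedding.abs_inner_sub_le {m n d : ℕ} {ε : ℝ} {X : Mat n d} {P : Mat m n}
    (hP : IsSubspaceEmbedding ε X P) (a b : Vec d) :
    |inner ℝ (act P (act X a)) (act P (act X b)) - inner ℝ (act X a) (act X b)|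
      ≤ ε * (‖act X a‖ * ‖act X b‖) :=
  abs_inner_map_sub_inner_le (isSubspaceEmbedding_iff.mp hP) ⟨_, a, rfl⟩ ⟨_, b, rfl⟩

lemma step_contraction {m n d : ℕ} {P : Mat m n} {X : Mat n d} {y : Vec n} {h : Vec d → ℝ}
    {c ε ρ : ℝ} {b β βstar : Vec d} (hc : Regime X h c)
    (hstar : IsCriticalPoint (objective X y h) βstar) (hρ0 : 0 ≤ ρ) (hcε : c < 1 - ε)
    (hρ : ε / (1 - ε - c) ≤ ρ) (hP : IsSubspaceEmbedding ε X P)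
    (hβ : IsMinOn (stepObjective P X y h b) Set.univ β) :
    seminormX X (β - βstar) ≤ ρ * seminormX X (b - βstar) := by
  have h1 := step_inequality hc hstar hβ
  have h2 := (abs_le.mp (hP.abs_inner_sub_le (b - βstar) (β - βstar))).2
  have h3 := (hP (β - βstar)).1
  have h4 : act P (act X (β - b)) = act P (act X (β - βstar)) - act P (act X (b - βstar)) := by
    simp [act, ← map_sub]
  rw [h4, inner_sub_left, real_inner_self_eq_norm_sq] at h1
  rw [div_le_iff₀ (by linarith)] at hρ
  unfold seminormX
  set p := ‖act X (β - βstar)‖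
  set q := ‖act X (b - βstar)‖
  have hp : 0 ≤ p := norm_nonneg _
  have hq : 0 ≤ q := norm_nonneg _
  have h5 : (1 - ε - c) * p ^ 2 ≤ ε * (q * p) := by linarith
  have h6 : ε * (q * p) ≤ ρ * (1 - ε - c) * (q * p) := by gcongr
  rcases hp.eq_or_lt with h0 | h0
  · rw [← h0]; positivity
  · have h7 : (1 - ε - c) * p * p ≤ (1 - ε - c) * p * (ρ * q) := by nlinarith
    exact le_of_mul_le_mul_left h7 (mul_pos (by linarith) h0)

lemma run_contraction {m n d : ℕ} {P : Mat m n} {X : Mat n d} {y : Vec n} {h : Vec d → ℝ}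
    {c ε ρ : ℝ} {βstar : Vec d} (hc : Regime X h c)
    (hstar : IsCriticalPoint (objective X y h) βstar) (hρ0 : 0 ≤ ρ) (hcε : c < 1 - ε)
    (hρ : ε / (1 - ε - c) ≤ ρ) (hP : IsSubspaceEmbedding ε X P) (N : ℕ) (β : ℕ → Vec d)
    (hβ : IsIterativeSRO P X y h N β) :
    seminormX X (β N - βstar) ≤ ρ ^ N * seminormX X βstar := by
  have key : ∀ t ≤ N, seminormX X (β t - βstar) ≤ ρ ^ t * seminormX X βstar := by
    intro t
    induction t with
    | zero => intro _; simp [hβ.1, seminormX, act]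
    | succ t ih =>
      intro ht
      calc seminormX X (β (t + 1) - βstar) ≤ ρ * seminormX X (β t - βstar) :=
            step_contraction hc hstar hρ0 hcε hρ hP (hβ.2 t ht)
        _ ≤ ρ * (ρ ^ t * seminormX X βstar) := by gcongr; exact ih (by omega)
        _ = _ := by ring
  exact key N le_rfl

lemma WithProbAtLeast.mono {m n : ℕ} {μ : Measure (Mat m n)} {p : ℝ} {Q R : Mat m n → Prop}
    (hQ : WithProbAtLeast μ p Q) (h : ∀ P, Q P → R P) : WithProbAtLeast μ p R := by
  obtain ⟨A, hA, hp, hQ⟩ := hQ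
  exact ⟨A, hA, hp, fun P hP => h P (hQ P hP)⟩

/-! ### Concentration of the chi-square distribution -/

lemma integral_exp_mul_sq_gaussianReal {l : ℝ} (hl : l < 1 / 2) :
    ∫ x, Real.exp (l * x ^ 2) ∂(gaussianReal 0 1) = √(1 / (1 - 2 * l)) := by
  rw [integral_gaussianReal_eq_integral_smul one_ne_zero]
  have h1 : ∀ x : ℝ, gaussianPDFReal 0 1 x • Real.exp (l * x ^ 2)
      = (√(2 * Real.pi))⁻¹ * Real.exp (-(1 / 2 - l) * x ^ 2) := by
    intro x
    rw [gaussianPDFReal, smul_eq_mul, mul_assoc, ← Real.exp_add]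
    simp only [NNReal.coe_one, mul_one, sub_zero]
    congr 2
    ring
  simp_rw [h1]
  rw [integral_const_mul, integral_gaussian, ← Real.sqrt_inv,
    ← Real.sqrt_mul (by positivity)]
  congr 1
  have : (1 - 2 * l) ≠ 0 := by linarith
  have : (1 / 2 - l) ≠ 0 := by linarith
  field_simp

lemma integrable_exp_mul_sq_gaussianReal {l : ℝ} (hl : l < 1 / 2) :
    Integrable (fun x => Real.exp (l * x ^ 2)) (gaussianReal 0 1) := by
  refine Integrable.of_integral_ne_zero ?_
  rw [integral_exp_mul_sq_gaussianReal hl]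
  have : 0 < 1 - 2 * l := by linarith
  positivity

/-- After squaring, the claim is `exp z ≤ 1 - 2l` for `z = -(2l + 8l²)`. It follows from `exp z ≤ 1
+ z + z²`, where `|l| ≤ 1/10` ensures `4(1 + 4l)² ≤ 8`. -/
lemma integral_exp_mul_sq_gaussianReal_le {l : ℝ} (hl : |l| ≤ 1 / 10) :
    ∫ x, Real.exp (l * x ^ 2) ∂(gaussianReal 0 1) ≤ Real.exp (l + 4 * l ^ 2) := by
  obtain ⟨h1, h2⟩ := abs_le.mp hl
  rw [integral_exp_mul_sq_gaussianReal (by linarith)]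
  have h3 : 0 < 1 - 2 * l := by linarith
  rw [Real.sqrt_le_left (Real.exp_pos _).le, ← Real.exp_nat_mul, div_le_iff₀ h3]
  set z := -(2 * l + 8 * l ^ 2)
  have h4 : |z| ≤ 1 := by rw [abs_le]; constructor <;> simp only [z] <;> nlinarith
  have h5 := (abs_le.mp (Real.abs_exp_sub_one_sub_id_le h4)).2
  have h6 : 1 + z + z ^ 2 ≤ 1 - 2 * l := by
    have : 1 - 2 * l - (1 + z + z ^ 2) = l ^ 2 * (8 - 4 * (1 + 4 * l) ^ 2) := by
      simp only [z]; ring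
    have h7 : 0 ≤ 8 - 4 * (1 + 4 * l) ^ 2 := by nlinarith
    have : 0 ≤ l ^ 2 * (8 - 4 * (1 + 4 * l) ^ 2) := by positivity
    linarith
  have h8 : Real.exp z ≤ 1 - 2 * l := by linarith
  have h9 : ((2 : ℕ) : ℝ) * (l + 4 * l ^ 2) = -z := by simp only [z]; push_cast; ring
  rw [h9]
  calc 1 = Real.exp (-z) * Real.exp z := by rw [← Real.exp_add]; simp
    _ ≤ _ := by gcongr

lemma integrable_exp_mul_sum_sq (m : ℕ) {l : ℝ} (hl : l < 1 / 2) :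
    Integrable (fun z : Fin m → ℝ => Real.exp (l * ∑ j, z j ^ 2))
      (Measure.pi fun _ : Fin m => gaussianReal 0 1) := by
  simp_rw [Finset.mul_sum, Real.exp_sum]
  exact Integrable.fintype_prod (f := fun _ x => Real.exp (l * x ^ 2)) fun _ =>
    integrable_exp_mul_sq_gaussianReal hl

lemma integral_exp_mul_sum_sq_le (m : ℕ) {l : ℝ} (hl : |l| ≤ 1 / 10) :
    ∫ z, Real.exp (l * ∑ j, z j ^ 2) ∂(Measure.pi fun _ : Fin m => gaussianReal 0 1)
      ≤ Real.exp (m * (l + 4 * l ^ 2)) := by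
  simp_rw [Finset.mul_sum, Real.exp_sum]
  rw [integral_fintype_prod_eq_pow (fun x => Real.exp (l * x ^ 2)), Fintype.card_fin,
    Real.exp_nat_mul]
  exact pow_le_pow_left₀ (integral_nonneg fun x => (Real.exp_pos (l * x ^ 2)).le)
    (integral_exp_mul_sq_gaussianReal_le hl) m

/-- Chernoff's bound, with the sign `s` treating both tails together. The choice `l = st/10` gives
the exponent `m(4t²/100 - t²/10) = -(3/50)mt²`. -/
lemma chiSquare_tail (m : ℕ) {s t : ℝ} (hs : s ^ 2 = 1) (ht0 : 0 < t) (ht1 : t ≤ 1) :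
    (Measure.pi fun _ : Fin m => gaussianReal 0 1).real
      {z | m * t ≤ s * (∑ j, z j ^ 2 - m)} ≤ Real.exp (-(3 / 50 * m * t ^ 2)) := by
  obtain ⟨l, hl⟩ : ∃ l, l = s * t / 10 := ⟨_, rfl⟩
  have hsabs : |s| = 1 := by
    rwa [← sq_abs, pow_eq_one_iff_of_nonneg (abs_nonneg s) two_ne_zero] at hs
  have hl1 : |l| ≤ 1 / 10 := by
    rw [hl, abs_div, abs_mul, hsabs, abs_of_pos ht0, abs_of_pos (by norm_num : (0 : ℝ) < 10)]
    linarith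
  have hl2 : l < 1 / 2 := by linarith [(abs_le.mp hl1).2]
  have hsq : l ^ 2 = t ^ 2 / 100 := by rw [hl, div_pow, mul_pow, hs]; norm_num
  have hmarkov := mul_meas_ge_le_integral_of_nonneg
    (μ := Measure.pi fun _ : Fin m => gaussianReal 0 1)
    (f := fun z => Real.exp (l * ∑ j, z j ^ 2))
    (Eventually.of_forall fun z => (Real.exp_pos (l * ∑ j, z j ^ 2)).le)
    (integrable_exp_mul_sum_sq m hl2) (Real.exp (m * (l + t ^ 2 / 10)))
  have h1 := hmarkov.trans (integral_exp_mul_sum_sq_le m hl1)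
  rw [← le_div_iff₀' (Real.exp_pos _), ← Real.exp_sub] at h1
  refine le_trans (measureReal_mono fun z hz => ?_) (h1.trans (Real.exp_le_exp.mpr ?_))
  · simp only [Set.mem_ofPred_eq, Real.exp_le_exp] at hz ⊢
    have h2 := mul_le_mul_of_nonneg_left hz (by positivity : 0 ≤ t / 10)
    calc (m : ℝ) * (l + t ^ 2 / 10) = m * l + t / 10 * (m * t) := by ring
      _ ≤ m * l + t / 10 * (s * (∑ j, z j ^ 2 - m)) := by gcongr
      _ = l * ∑ j, z j ^ 2 := by rw [hl]; ring
  · rw [hsq]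
    apply le_of_eq
    ring

lemma chiSquare_concentration (m : ℕ) {t : ℝ} (ht0 : 0 < t) (ht1 : t ≤ 1) :
    (Measure.pi fun _ : Fin m => gaussianReal 0 1).real
      {z | m * t ≤ |∑ j, z j ^ 2 - m|} ≤ 2 * Real.exp (-(3 / 50 * m * t ^ 2)) := by
  have h : {z : Fin m → ℝ | m * t ≤ |∑ j, z j ^ 2 - m|}
      ⊆ {z | m * t ≤ 1 * (∑ j, z j ^ 2 - m)} ∪ {z | m * t ≤ (-1) * (∑ j, z j ^ 2 - m)} := by
    intro z hz
    simpa [le_abs] using hz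
  calc _ ≤ _ := measureReal_mono h
    _ ≤ _ := measureReal_union_le _ _
    _ ≤ _ := by
      rw [two_mul]
      exact add_le_add (chiSquare_tail m (by norm_num) ht0 ht1)
        (chiSquare_tail m (by norm_num) ht0 ht1)

/-! ### The Gaussian sketch of a fixed vector -/

lemma map_inner_pi_gaussianReal {n : ℕ} {u : Vec n} (hu : ‖u‖ = 1) :
    (Measure.pi fun _ : Fin n => gaussianReal 0 1).map (fun a => ∑ i, a i * u i)
      = gaussianReal 0 1 := by
  have h1 : (fun a : Fin n → ℝ => ∑ i, a i * u i) = (innerSL ℝ u) ∘ (WithLp.toLp 2) := by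
    ext a
    simp [PiLp.inner_apply]
  rw [h1, ← Measure.map_map (by fun_prop) (by fun_prop), map_pi_eq_stdGaussian,
    IsGaussian.map_eq_gaussianReal, integral_strongDual_stdGaussian, variance_dual_stdGaussian]
  simp [hu]

/-- By rotation invariance each row contributes a standard normal, and rows are independent; hence
the squared norm of the image of a unit vector is chi-square. -/
lemma map_mulVec_pi_gaussianReal (m : ℕ) {n : ℕ} {u : Vec n} (hu : ‖u‖ = 1) :
    (Measure.pi fun _ : Fin m => Measure.pi fun _ : Fin n => gaussianReal 0 1).map
      (fun A j => ∑ i, A j i * u i) = Measure.pi fun _ : Fin m => gaussianReal 0 1 := by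
  have h := map_inner_pi_gaussianReal hu
  have : IsProbabilityMeasure ((Measure.pi fun _ : Fin n => gaussianReal 0 1).map
      (fun a : Fin n → ℝ => ∑ i, a i * u i)) := by rw [h]; infer_instance
  rw [Measure.pi_map_pi (μ := fun _ : Fin m => Measure.pi fun _ : Fin n => gaussianReal 0 1)
    (f := fun _ a => ∑ i, a i * u i)
    fun _ => Measurable.aemeasurable (by fun_prop), h]

lemma act_apply {m n : ℕ} (P : Mat m n) (u : Vec n) (j : Fin m) :
    act P u j = ∑ i, P j i * u i := by
  simp [act, Matrix.toLpLin_apply, Matrix.mulVec, dotProduct]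

lemma measurable_entry {m n : ℕ} (j : Fin m) (i : Fin n) : Measurable fun P : Mat m n => P j i :=
  (measurable_pi_apply i).comp (measurable_pi_apply (X := fun _ : Fin m => Fin n → ℝ) j)

lemma measurable_inner_act {m n : ℕ} (u v : Vec n) :
    Measurable fun P : Mat m n => inner ℝ (act P u) (act P v) := by
  simp only [PiLp.inner_apply, act_apply]
  refine Finset.measurable_sum _ fun j _ => ?_
  have h : ∀ w : Vec n, Measurable fun P : Mat m n => ∑ i, P j i * w i := fun w =>
    Finset.measurable_sum _ fun i _ => (measurable_entry j i).mul_const _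
  exact (h u).inner (h v)

lemma measurable_norm_act_sq {m n : ℕ} (u : Vec n) :
    Measurable fun P : Mat m n => ‖act P u‖ ^ 2 := by
  simpa only [real_inner_self_eq_norm_sq] using measurable_inner_act u u

lemma measurable_gaussianScaling (m n : ℕ) :
    Measurable fun A : Fin m → Fin n → ℝ => (Matrix.of fun j i => A j i / √(m : ℝ) : Mat m n) := by
  refine measurable_pi_lambda _ fun j => measurable_pi_lambda _ fun i => ?_
  exact ((measurable_pi_apply i).comp
    (measurable_pi_apply (X := fun _ : Fin m => Fin n → ℝ) j)).div_const _

instance isProbabilityMeasure_gaussianSketch (m n : ℕ) :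
    IsProbabilityMeasure (gaussianSketch m n) :=
  Measure.isProbabilityMeasure_map (measurable_gaussianScaling m n).aemeasurable

lemma gaussianSketch_distortion_unit {m n : ℕ} (hm : 0 < m) {u : Vec n} (hu : ‖u‖ = 1) {t : ℝ}
    (ht0 : 0 < t) (ht1 : t ≤ 1) :
    (gaussianSketch m n).real {P | t < |‖act P u‖ ^ 2 - 1|}
      ≤ 2 * Real.exp (-(3 / 50 * m * t ^ 2)) := by
  refine le_trans ?_ (chiSquare_concentration m ht0 ht1)
  have hm' : (0 : ℝ) < m := by exact_mod_cast hm
  have hmeas : MeasurableSet {P : Mat m n | t < |‖act P u‖ ^ 2 - 1|} :=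
    measurableSet_lt measurable_const
      (continuous_abs.measurable.comp ((measurable_norm_act_sq u).sub_const 1))
  have hmeas' : MeasurableSet {z : Fin m → ℝ | m * t ≤ |∑ j, z j ^ 2 - m|} :=
    measurableSet_le measurable_const (by fun_prop)
  rw [gaussianSketch, map_measureReal_apply (measurable_gaussianScaling m n) hmeas,
    ← map_mulVec_pi_gaussianReal m hu, map_measureReal_apply (by fun_prop) hmeas']
  refine measureReal_mono fun A hA => ?_
  simp only [Set.mem_preimage, Set.mem_ofPred_eq] at hA ⊢
  have h1 : ‖act (Matrix.of fun j i => A j i / √(m : ℝ) : Mat m n) u‖ ^ 2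
      = (∑ j, (∑ i, A j i * u i) ^ 2) / m := by
    rw [EuclideanSpace.real_norm_sq_eq, Finset.sum_div]
    refine Finset.sum_congr rfl fun j _ => ?_
    rw [act_apply]
    have : ∑ i, (Matrix.of fun j i => A j i / √(m : ℝ) : Mat m n) j i * u i
        = (∑ i, A j i * u i) / √(m : ℝ) := by
      rw [Finset.sum_div]
      exact Finset.sum_congr rfl fun i _ => by simp [div_mul_eq_mul_div]
    rw [this, div_pow, Real.sq_sqrt hm'.le]
  rw [h1] at hA
  set S := ∑ j, (∑ i, A j i * u i) ^ 2
  have h2 : S - m = m * (S / m - 1) := by field_simp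
  rw [h2, abs_mul, abs_of_pos hm']
  gcongr

lemma gaussianSketch_distortion {m n : ℕ} (hm : 0 < m) (w : Vec n) {t : ℝ}
    (ht0 : 0 < t) (ht1 : t ≤ 1) :
    (gaussianSketch m n).real {P | t * ‖w‖ ^ 2 < |‖act P w‖ ^ 2 - ‖w‖ ^ 2|}
      ≤ 2 * Real.exp (-(3 / 50 * m * t ^ 2)) := by
  rcases eq_or_ne w 0 with rfl | hw
  · simp [act]
    positivity
  have hw0 := norm_pos_iff.mpr hw
  refine le_trans (measureReal_mono fun P hP => ?_) (gaussianSketch_distortion_unit hm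
    (u := ‖w‖⁻¹ • w) (by rw [norm_smul, norm_inv, norm_norm, inv_mul_cancel₀ hw0.ne']) ht0 ht1)
  simp only [Set.mem_ofPred_eq] at hP ⊢
  have h1 : ‖act P (‖w‖⁻¹ • w)‖ ^ 2 = ‖act P w‖ ^ 2 / ‖w‖ ^ 2 := by
    rw [act, map_smul, norm_smul, norm_inv, norm_norm, mul_pow, inv_pow]
    field_simp
  rw [h1, div_sub_one (by positivity), abs_div, abs_of_pos (by positivity : 0 < ‖w‖ ^ 2),
    lt_div_iff₀ (by positivity)]
  exact hP

/-! ### Nets of the unit ball -/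

section Net

variable {E : Type*} [NormedAddCommGroup E] [InnerProductSpace ℝ E] [FiniteDimensional ℝ E]

/-- A largest 1/2-separated subset of the unit ball is a net, as an uncovered point could be added.
Doubling it gives 1-separated points in the ball of radius 2, where a packing bound yields `5 ^
dim`. -/
lemma exists_half_net :
    ∃ s : Finset E, s.card ≤ 5 ^ Module.finrank ℝ E ∧
      ∀ v : E, ‖v‖ ≤ 1 → ∃ w ∈ s, ‖v - w‖ ≤ 1 / 2 := by
  classical
  let p : Finset E → Prop := fun s =>
    (∀ c ∈ s, ‖c‖ ≤ 1) ∧ ∀ c ∈ s, ∀ e ∈ s, c ≠ e → 1 / 2 ≤ ‖c - e‖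
  have hcard : ∀ s, p s → s.card ≤ 5 ^ Module.finrank ℝ E := by
    intro s hs
    have hinj : Function.Injective fun v : E => (2 : ℝ) • v := smul_right_injective E two_ne_zero
    rw [← Finset.card_image_of_injective s hinj]
    refine Besicovitch.card_le_of_separated _ ?_ ?_
    · simp only [Finset.mem_image, forall_exists_index, and_imp, forall_apply_eq_imp_iff₂]
      intro c hc
      have := hs.1 c hc
      rw [norm_smul, Real.norm_two]
      linarith
    · simp only [Finset.mem_image, forall_exists_index, and_imp, forall_apply_eq_imp_iff₂]
      intro c hc e he hce
      have := hs.2 c hc e he fun h => hce (by rw [h])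
      rw [← smul_sub, norm_smul, Real.norm_two]
      linarith
  have hP : ∃ k, (∃ s, p s ∧ s.card = k) ∧ ∀ j, (∃ s, p s ∧ s.card = j) → j ≤ k := by
    have hb : BddAbove {k | ∃ s, p s ∧ s.card = k} :=
      ⟨5 ^ Module.finrank ℝ E, by rintro _ ⟨s, hs, rfl⟩; exact hcard s hs⟩
    exact ⟨sSup _, Nat.sSup_mem (s := {k | ∃ s, p s ∧ s.card = k}) ⟨0, ∅, by simp [p], rfl⟩ hb,
      fun j hj => le_csSup hb hj⟩
  obtain ⟨k, ⟨s, hs, rfl⟩, hmax⟩ := hP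
  refine ⟨s, hcard s hs, fun v hv => ?_⟩
  by_contra! hcon
  have hvs : v ∉ s := fun h => by
    have := hcon v h
    simp at this
    linarith
  have : p (insert v s) := by
    refine ⟨?_, ?_⟩
    · intro c hc
      rcases Finset.mem_insert.mp hc with rfl | hc
      · exact hv
      · exact hs.1 c hc
    · intro c hc e he hce
      rcases Finset.mem_insert.mp hc with hcv | hc <;>
        rcases Finset.mem_insert.mp he with hev | he
      · exact absurd (hcv.trans hev.symm) hce
      · rw [hcv]; exact (hcon e he).le
      · rw [hev, norm_sub_rev]; exact (hcon c hc).le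
      · exact hs.2 c hc e he hce
  have := hmax _ ⟨_, this, rfl⟩
  rw [Finset.card_insert_of_notMem hvs] at this
  omega

/-- The half net is used twice: the doubled residual `2(v - a)` is again in the unit ball, and
approximating it halves the error. -/
lemma exists_quarter_net :
    ∃ s : Finset E, s.card ≤ 25 ^ Module.finrank ℝ E ∧
      ∀ v : E, ‖v‖ ≤ 1 → ∃ w ∈ s, ‖v - w‖ ≤ 1 / 4 := by
  classical
  obtain ⟨s, hs, hnet⟩ := exists_half_net (E := E)
  refine ⟨Finset.image₂ (fun a b => a + (1 / 2 : ℝ) • b) s s, ?_, fun v hv => ?_⟩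
  · calc _ ≤ s.card * s.card := Finset.card_image₂_le _ _ _
      _ ≤ 5 ^ Module.finrank ℝ E * 5 ^ Module.finrank ℝ E := Nat.mul_le_mul hs hs
      _ = _ := by rw [← mul_pow]; norm_num
  · obtain ⟨a, ha, hva⟩ := hnet v hv
    obtain ⟨b, hb, hvb⟩ := hnet ((2 : ℝ) • (v - a)) (by
      rw [norm_smul, Real.norm_two]; linarith)
    refine ⟨_, Finset.mem_image₂_of_mem ha hb, ?_⟩
    have : v - (a + (1 / 2 : ℝ) • b) = (1 / 2 : ℝ) • ((2 : ℝ) • (v - a) - b) := by module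
    rw [this, norm_smul]
    norm_num at hvb ⊢
    linarith

/-- Let `M` be the maximal distortion on the unit ball, attained at `v₀`, and `w` a nearby net
point. The distortions at `v₀` and `w` differ by the polarized form at `(v₀ - w, v₀ + w)`, which is
at most `M · 1/4 · 9/4`. As `‖w‖ ≤ 5/4`, this gives `M ≤ 9/16 M + 25/16 t`. -/
lemma distortion_le_of_net {F : Type*} [NormedAddCommGroup F] [InnerProductSpace ℝ F]
    (T : E →ₗ[ℝ] F) {s : Finset E} (hnet : ∀ v : E, ‖v‖ ≤ 1 → ∃ w ∈ s, ‖v - w‖ ≤ 1 / 4) {t : ℝ}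
    (ht : 0 ≤ t) (hT : ∀ w ∈ s, |‖T w‖ ^ 2 - ‖w‖ ^ 2| ≤ t * ‖w‖ ^ 2) (v : E) :
    |‖T v‖ ^ 2 - ‖v‖ ^ 2| ≤ 25 / 7 * t * ‖v‖ ^ 2 := by
  have hTc : Continuous T := T.continuous_of_finiteDimensional
  obtain ⟨v₀, hv₀, hmax⟩ := (isCompact_closedBall (0 : E) 1).exists_isMaxOn
    ⟨0, by simp⟩ (f := fun v => |‖T v‖ ^ 2 - ‖v‖ ^ 2|) (by fun_prop)
  set M := |‖T v₀‖ ^ 2 - ‖v₀‖ ^ 2| with hM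
  have hv₀ : ‖v₀‖ ≤ 1 := by simpa using hv₀
  have hall : ∀ v, |‖T v‖ ^ 2 - ‖v‖ ^ 2| ≤ M * ‖v‖ ^ 2 := by
    intro v
    rcases eq_or_ne v 0 with rfl | hv
    · simp
    have hv0 := norm_pos_iff.mpr hv
    have h1 : |‖T (‖v‖⁻¹ • v)‖ ^ 2 - ‖‖v‖⁻¹ • v‖ ^ 2| ≤ M := hmax (by
      simp [norm_smul, inv_mul_cancel₀ hv0.ne'])
    rw [map_smul, norm_smul, norm_smul, norm_inv, norm_norm, mul_pow, mul_pow, ← mul_sub, abs_mul,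
      abs_of_nonneg (by positivity), inv_pow, inv_mul_le_iff₀ (by positivity)] at h1
    linarith
  have hM0 : 0 ≤ M := abs_nonneg _
  obtain ⟨w, hws, hw⟩ := hnet v₀ hv₀
  have hw1 : ‖w‖ ≤ 5 / 4 := by
    have : ‖w‖ ≤ ‖v₀‖ + ‖v₀ - w‖ := by
      simpa using norm_sub_le v₀ (v₀ - w)
    linarith
  have h1 := abs_inner_map_sub_inner_le hall (v₀ - w) (v₀ + w)
  have h2 : inner ℝ (T (v₀ - w)) (T (v₀ + w)) - inner ℝ (v₀ - w) (v₀ + w)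
      = (‖T v₀‖ ^ 2 - ‖v₀‖ ^ 2) - (‖T w‖ ^ 2 - ‖w‖ ^ 2) := by
    simp only [map_sub, map_add, inner_sub_left, inner_add_right, real_inner_self_eq_norm_sq]
    rw [real_inner_comm (T v₀) (T w), real_inner_comm v₀ w]
    ring
  rw [h2] at h1
  have h3 := norm_add_le v₀ w
  have h4 : ‖v₀ - w‖ * ‖v₀ + w‖ ≤ 1 / 4 * (9 / 4) := by
    gcongr
    linarith
  have h5 : M * (‖v₀ - w‖ * ‖v₀ + w‖) ≤ M * (1 / 4 * (9 / 4)) := by gcongr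
  have h6 : t * ‖w‖ ^ 2 ≤ t * (5 / 4) ^ 2 := by gcongr
  have h7 := hT w hws
  have h8 := abs_sub_abs_le_abs_sub (‖T v₀‖ ^ 2 - ‖v₀‖ ^ 2) (‖T w‖ ^ 2 - ‖w‖ ^ 2)
  have h9 : M ≤ 25 / 7 * t := by linarith
  calc _ ≤ M * ‖v‖ ^ 2 := hall v
    _ ≤ _ := by gcongr

end Net

/-! ### Gaussian sketches are subspace embeddings -/

lemma withProbAtLeast_of_compl {m n : ℕ} {μ : Measure (Mat m n)} [IsProbabilityMeasure μ]
    {δ : ℝ} {B : Set (Mat m n)} {Q : Mat m n → Prop} (hB : MeasurableSet B) (hδ : μ.real B ≤ δ)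
    (hQ : ∀ P ∉ B, Q P) : WithProbAtLeast μ (1 - δ) Q := by
  refine ⟨Bᶜ, hB.compl, ?_, hQ⟩
  rw [← ofReal_measureReal, measureReal_compl hB]
  refine ENNReal.ofReal_le_ofReal ?_
  simp
  linarith

lemma gaussianSketch_isSubspaceEmbedding {m n d : ℕ} (X : Mat n d) {ε δ : ℝ} (hε0 : 0 < ε)
    (hε1 : ε ≤ 1) (hδ0 : 0 < δ) (hδ1 : δ < 1)
    (hm : 1000 * ((X.rank : ℝ) + Real.log (1 / δ)) / ε ^ 2 ≤ m) :
    WithProbAtLeast (gaussianSketch m n) (1 - δ) (IsSubspaceEmbedding ε X) := by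
  have hlog : 0 < Real.log (1 / δ) := Real.log_pos (by rw [lt_div_iff₀ hδ0]; linarith)
  have hm0 : 0 < m := by
    have : (0 : ℝ) < m := lt_of_lt_of_le (by positivity) hm
    exact_mod_cast this
  obtain ⟨s, hs, hnet⟩ := exists_quarter_net (E := (Matrix.toEuclideanLin X).range)
  rw [finrank_range_toEuclideanLin] at hs
  -- Chosen so that the loss `25/7` of `distortion_le_of_net` returns exactly `ε`.
  set t := 7 / 25 * ε with ht
  have ht0 : 0 < t := by positivity
  set B : Set (Mat m n) := ⋃ w ∈ s, {P | t * ‖(w : Vec n)‖ ^ 2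
    < |‖act P (w : Vec n)‖ ^ 2 - ‖(w : Vec n)‖ ^ 2|}
  -- Rank zero is separate because absorbing the factor 2 through `2 * 25 ^ r ≤ 50 ^ r ≤ exp (4r)`
  -- needs `r ≥ 1`.
  rcases Nat.eq_zero_or_pos X.rank with hr | hr
  · refine ⟨Set.univ, MeasurableSet.univ, ?_, fun P _ => ?_⟩
    · rw [measure_univ, ← ENNReal.ofReal_one]
      exact ENNReal.ofReal_le_ofReal (by linarith)
    · rw [isSubspaceEmbedding_iff]
      intro v
      have : Subsingleton (Matrix.toEuclideanLin X).range := by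
        rw [← Module.finrank_zero_iff (R := ℝ), finrank_range_toEuclideanLin, hr]
      rw [Subsingleton.elim v 0]
      simp
  refine withProbAtLeast_of_compl (B := B) ?_ ?_ ?_
  · refine Finset.measurableSet_biUnion _ fun w _ => measurableSet_lt measurable_const
      (continuous_abs.measurable.comp ((measurable_norm_act_sq _).sub_const _))
  · have h1 : (gaussianSketch m n).real B ≤ ∑ _w ∈ s, 2 * Real.exp (-(3 / 50 * m * t ^ 2)) :=
      (measureReal_biUnion_finset_le _ _).trans
        (Finset.sum_le_sum fun w _ => gaussianSketch_distortion hm0 _ ht0 (by linarith))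
    rw [Finset.sum_const, nsmul_eq_mul] at h1
    have h2 : (s.card : ℝ) ≤ 25 ^ X.rank := by exact_mod_cast hs
    have h3 : (2 : ℝ) * 25 ^ X.rank ≤ Real.exp (4 * X.rank) := by
      have h4 : (50 : ℝ) ≤ Real.exp 4 := by
        have := Real.exp_one_gt_d9
        have h5 : Real.exp 4 = Real.exp 1 ^ 4 := by rw [← Real.exp_nat_mul]; norm_num
        rw [h5]
        calc (50 : ℝ) ≤ 2.7182818283 ^ 4 := by norm_num
          _ ≤ _ := by gcongr
      calc (2 : ℝ) * 25 ^ X.rank ≤ 2 ^ X.rank * 25 ^ X.rank := by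
            gcongr
            exact le_self_pow₀ (by norm_num) hr.ne'
        _ = 50 ^ X.rank := by rw [← mul_pow]; norm_num
        _ ≤ Real.exp 4 ^ X.rank := by gcongr
        _ = _ := by rw [← Real.exp_nat_mul, mul_comm]
    -- Here `1000 · 3/50 · 49/625 = 4.704`, which covers both `4r` and `log (1/δ)`.
    have h5 : 4 * (X.rank : ℝ) - 3 / 50 * m * t ^ 2 ≤ Real.log δ := by
      rw [div_le_iff₀ (by positivity)] at hm
      have h6 : Real.log δ = - Real.log (1 / δ) := by simp
      have h7 : (0 : ℝ) < X.rank := by exact_mod_cast hr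
      have h8 : t ^ 2 = 49 / 625 * ε ^ 2 := by rw [ht]; ring
      rw [h6, h8]
      nlinarith
    calc _ ≤ (s.card : ℝ) * (2 * Real.exp (-(3 / 50 * m * t ^ 2))) := h1
      _ ≤ 25 ^ X.rank * (2 * Real.exp (-(3 / 50 * m * t ^ 2))) := by gcongr
      _ = 2 * 25 ^ X.rank * Real.exp (-(3 / 50 * m * t ^ 2)) := by ring
      _ ≤ Real.exp (4 * X.rank) * Real.exp (-(3 / 50 * m * t ^ 2)) := by gcongr
      _ = Real.exp (4 * X.rank - 3 / 50 * m * t ^ 2) := by rw [← Real.exp_add]; ring_nf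
      _ ≤ Real.exp (Real.log δ) := Real.exp_le_exp.mpr h5
      _ = δ := Real.exp_log hδ0
  · intro P hP
    rw [isSubspaceEmbedding_iff]
    have h1 : ∀ w ∈ s, |‖rangeAct X P w‖ ^ 2 - ‖w‖ ^ 2| ≤ t * ‖w‖ ^ 2 := by
      simpa [B, rangeAct] using hP
    intro v
    have := distortion_le_of_net (rangeAct X P) hnet ht0.le h1 v
    rw [ht] at this
    linarith

/-! ### Collisions in the sparse sketch -/

/-- The inner product of the distinct columns `p.1` and `p.2` of the sparse matrix, and `0` if
`p.1 = p.2`. -/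
def columnInner {m n : ℕ} (w : Fin n → Fin m × ℤˣ) (p : Fin n × Fin n) : ℝ :=
  if p.1 ≠ p.2 ∧ (w p.1).1 = (w p.2).1 then (((w p.1).2 : ℤ) : ℝ) * (((w p.2).2 : ℤ) : ℝ) else 0

lemma sign_mul_self (s : ℤˣ) : ((s : ℤ) : ℝ) * ((s : ℤ) : ℝ) = 1 := by
  rcases Int.units_eq_one_or s with rfl | rfl <;> simp

/-- The columns are unit vectors, so `PᵀP - I` has zero diagonal and only collisions between
distinct columns remain. -/
lemma inner_act_sparseMatrix_sub {m n : ℕ} (w : Fin n → Fin m × ℤˣ) (x y : Vec n) :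
    inner ℝ (act (sparseMatrix w) x) (act (sparseMatrix w) y) - inner ℝ x y
      = ∑ p : Fin n × Fin n, x p.1 * y p.2 * columnInner w p := by
  have h1 : inner ℝ (act (sparseMatrix w) x) (act (sparseMatrix w) y)
      = ∑ i, ∑ k, x i * y k * ∑ j, sparseMatrix w j i * sparseMatrix w j k := by
    simp only [PiLp.inner_apply, act_apply, RCLike.inner_apply, conj_trivial]
    simp only [Finset.mul_sum (s := Finset.univ (α := Fin m))]
    calc _ = ∑ j, ∑ i, ∑ k, x i * y k * (sparseMatrix w j i * sparseMatrix w j k) := by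
          refine Finset.sum_congr rfl fun j _ => ?_
          rw [mul_comm, Finset.sum_mul_sum]
          refine Finset.sum_congr rfl fun i _ => Finset.sum_congr rfl fun k _ => ?_
          ring
      _ = ∑ i, ∑ j, ∑ k, x i * y k * (sparseMatrix w j i * sparseMatrix w j k) :=
          Finset.sum_comm
      _ = _ := Finset.sum_congr rfl fun i _ => Finset.sum_comm
  have h2 : inner ℝ x y = ∑ i, ∑ k, x i * y k * if i = k then 1 else 0 := by
    simp [PiLp.inner_apply, mul_comm]
  rw [h1, h2, Fintype.sum_prod_type, ← Finset.sum_sub_distrib]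
  refine Finset.sum_congr rfl fun i _ => ?_
  rw [← Finset.sum_sub_distrib]
  refine Finset.sum_congr rfl fun k _ => ?_
  rw [← mul_sub]
  congr 1
  have h3 : ∑ j, sparseMatrix w j i * sparseMatrix w j k
      = if (w i).1 = (w k).1 then (((w i).2 : ℤ) : ℝ) * (((w k).2 : ℤ) : ℝ) else 0 := by
    simp [sparseMatrix, eq_comm]
  rw [h3, columnInner]
  by_cases hik : i = k
  · subst hik
    simp [sign_mul_self]
  · simp [hik]

/-- Flipping the sign of column `j`. -/
def flipSign {m n : ℕ} (j : Fin n) : (Fin n → Fin m × ℤˣ) ≃ (Fin n → Fin m × ℤˣ) :=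
  Equiv.piCongrRight fun i => if i = j then (Equiv.refl _).prodCongr (Equiv.neg _) else Equiv.refl _

lemma columnInner_flipSign_of_mem {m n : ℕ} (j : Fin n) (w : Fin n → Fin m × ℤˣ)
    {p : Fin n × Fin n} (hp : j = p.1 ∨ j = p.2) :
    columnInner (flipSign j w) p = - columnInner w p := by
  obtain ⟨i, k⟩ := p
  by_cases hik : i = k
  · simp [columnInner, hik]
  rcases hp with rfl | rfl
  · simp [columnInner, flipSign, hik, Ne.symm hik, apply_ite]
  · simp [columnInner, flipSign, hik, apply_ite]

lemma columnInner_flipSign_of_notMem {m n : ℕ} (j : Fin n) (w : Fin n → Fin m × ℤˣ)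
    {p : Fin n × Fin n} (hp : j ≠ p.1 ∧ j ≠ p.2) :
    columnInner (flipSign j w) p = columnInner w p := by
  simp [columnInner, flipSign, hp.1.symm, hp.2.symm]

/-- For pairs of distinct indices, some column of `p` does not occur in `q`; flipping its sign is a
bijection that negates the summand. -/
lemma sum_columnInner_mul_eq_zero {m n : ℕ} {p q : Fin n × Fin n} (hpq : q ≠ p)
    (hpq' : q ≠ p.swap) : ∑ w : Fin n → Fin m × ℤˣ, columnInner w p * columnInner w q = 0 := by
  obtain ⟨i, k⟩ := p
  obtain ⟨i', k'⟩ := q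
  by_cases hik' : i' = k'
  · simp [columnInner, hik']
  have key : ∀ j, (j = i ∨ j = k) → (j ≠ i' ∧ j ≠ k') →
      ∑ w : Fin n → Fin m × ℤˣ, columnInner w (i, k) * columnInner w (i', k') = 0 := by
    intro j h1 h2
    have h3 := Equiv.sum_comp (flipSign (m := m) j)
      fun w => columnInner w (i, k) * columnInner w (i', k')
    simp only [columnInner_flipSign_of_mem j _ (p := (i, k)) h1,
      columnInner_flipSign_of_notMem j _ (p := (i', k')) h2, neg_mul, Finset.sum_neg_distrib] at h3
    linarith
  by_cases hik : i = k
  · simp [columnInner, hik]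
  by_cases h1 : i ≠ i' ∧ i ≠ k'
  · exact key i (Or.inl rfl) h1
  by_cases h2 : k ≠ i' ∧ k ≠ k'
  · exact key k (Or.inr rfl) h2
  exfalso
  simp only [Prod.swap, ne_eq, Prod.mk.injEq] at hpq hpq'
  grind

/-- Shifting the row of column `j` by `s`. -/
def shiftRow {m n : ℕ} [NeZero m] (j : Fin n) (s : Fin m) :
    (Fin n → Fin m × ℤˣ) ≃ (Fin n → Fin m × ℤˣ) :=
  Equiv.piCongrRight fun i =>
    if i = j then (Equiv.addLeft s).prodCongr (Equiv.refl _) else Equiv.refl _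

/-- Among the `m` cyclic shifts of the row of column `i`, exactly one hits the row of column `k`: a
collision has probability `1/m`. -/
lemma mul_sum_collision {m n : ℕ} [NeZero m] {i k : Fin n} (hik : i ≠ k) :
    (m : ℝ) * ∑ w : Fin n → Fin m × ℤˣ, (if (w i).1 = (w k).1 then (1 : ℝ) else 0)
      = Fintype.card (Fin n → Fin m × ℤˣ) := by
  have h1 : ∀ s : Fin m, ∑ w : Fin n → Fin m × ℤˣ, (if (w i).1 = (w k).1 then (1 : ℝ) else 0)
      = ∑ w : Fin n → Fin m × ℤˣ, (if s = (w k).1 - (w i).1 then (1 : ℝ) else 0) := by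
    intro s
    rw [← Equiv.sum_comp (shiftRow i s)]
    refine Finset.sum_congr rfl fun w _ => ?_
    simp [shiftRow, hik.symm, eq_sub_iff_add_eq]
  calc (m : ℝ) * ∑ w : Fin n → Fin m × ℤˣ, (if (w i).1 = (w k).1 then (1 : ℝ) else 0)
      = ∑ s : Fin m, ∑ w : Fin n → Fin m × ℤˣ, (if (w i).1 = (w k).1 then (1 : ℝ) else 0) := by
        simp only [Finset.sum_const, Finset.card_univ, Fintype.card_fin, nsmul_eq_mul]
    _ = ∑ s : Fin m, ∑ w : Fin n → Fin m × ℤˣ, (if s = (w k).1 - (w i).1 then (1 : ℝ) else 0) :=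
        Finset.sum_congr rfl fun s _ => h1 s
    _ = ∑ w : Fin n → Fin m × ℤˣ, 1 := by
        rw [Finset.sum_comm]
        refine Finset.sum_congr rfl fun w _ => ?_
        rw [Finset.sum_ite_eq' Finset.univ]
        simp
    _ = _ := by simp only [Finset.sum_const, Finset.card_univ, nsmul_eq_mul, mul_one]

lemma columnInner_swap {m n : ℕ} (w : Fin n → Fin m × ℤˣ) (p : Fin n × Fin n) :
    columnInner w p.swap = columnInner w p := by
  simp only [columnInner, Prod.swap, ne_comm, eq_comm, mul_comm]

lemma sum_columnInner_sq_le {m n : ℕ} (hm : 0 < m) (p : Fin n × Fin n) :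
    ∑ w : Fin n → Fin m × ℤˣ, columnInner w p ^ 2
      ≤ Fintype.card (Fin n → Fin m × ℤˣ) / m := by
  have : NeZero m := ⟨hm.ne'⟩
  have hm' : (0 : ℝ) < m := by exact_mod_cast hm
  by_cases hp : p.1 = p.2
  · simp only [columnInner, hp]
    simp only [ne_eq, not_true_eq_false, false_and, if_false, zero_pow two_ne_zero,
      Finset.sum_const_zero]
    positivity
  · rw [le_div_iff₀' hm', ← mul_sum_collision hp]
    refine mul_le_mul_of_nonneg_left (Finset.sum_le_sum fun w _ => le_of_eq ?_) hm'.le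
    by_cases h : (w p.1).1 = (w p.2).1
    · simp only [columnInner, hp, h, ne_eq, not_false_eq_true, and_self, if_true]
      rw [mul_pow, pow_two, pow_two, sign_mul_self, sign_mul_self, one_mul]
    · simp [columnInner, h]

lemma sum_sq_sum_columnInner_le {m n : ℕ} (hm : 0 < m) (a : Fin n × Fin n → ℝ) :
    ∑ w : Fin n → Fin m × ℤˣ, (∑ p, a p * columnInner w p) ^ 2
      ≤ 2 * (Fintype.card (Fin n → Fin m × ℤˣ) / m) * ∑ p, a p ^ 2 := by
  set c : ℝ := Fintype.card (Fin n → Fin m × ℤˣ) / m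
  have hc : 0 ≤ c := by positivity
  have h1 : ∑ w : Fin n → Fin m × ℤˣ, (∑ p, a p * columnInner w p) ^ 2
      = ∑ p, ∑ q, a p * a q * ∑ w : Fin n → Fin m × ℤˣ, columnInner w p * columnInner w q := by
    simp_rw [pow_two, Finset.sum_mul_sum]
    rw [Finset.sum_comm]
    refine Finset.sum_congr rfl fun p _ => ?_
    rw [Finset.sum_comm]
    refine Finset.sum_congr rfl fun q _ => ?_
    rw [Finset.mul_sum]
    refine Finset.sum_congr rfl fun w _ => ?_
    ring
  -- Only `q = p` and `q = p.swap` survive. When these coincide both bounds are added, harmlessly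
  -- since they are nonnegative; together they produce the factor 2.
  have h2 : ∀ p q, a p * a q * ∑ w : Fin n → Fin m × ℤˣ, columnInner w p * columnInner w q
      ≤ (if q = p then c * a p ^ 2 else 0)
        + if q = p.swap then c * ((a p ^ 2 + a p.swap ^ 2) / 2) else 0 := by
    intro p q
    have hS := sum_columnInner_sq_le hm p
    have hS0 : 0 ≤ ∑ w : Fin n → Fin m × ℤˣ, columnInner w p ^ 2 :=
      Finset.sum_nonneg fun _ _ => sq_nonneg _
    by_cases hq : q = p
    · have h3 : 0 ≤ if q = p.swap then c * ((a p ^ 2 + a p.swap ^ 2) / 2) else 0 := by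
        split_ifs <;> positivity
      subst hq
      rw [if_pos rfl]
      simp only [← pow_two]
      have := mul_le_mul_of_nonneg_left hS (sq_nonneg (a q))
      linarith
    by_cases hq' : q = p.swap
    · subst hq'
      rw [if_neg hq, if_pos rfl, zero_add]
      simp only [columnInner_swap, ← pow_two]
      have h3 : a p * a p.swap ≤ (a p ^ 2 + a p.swap ^ 2) / 2 := by
        linarith [two_mul_le_add_sq (a p) (a p.swap)]
      calc _ ≤ (a p ^ 2 + a p.swap ^ 2) / 2 * ∑ w : Fin n → Fin m × ℤˣ, columnInner w p ^ 2 := by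
            gcongr
        _ ≤ (a p ^ 2 + a p.swap ^ 2) / 2 * c := by gcongr
        _ = _ := mul_comm _ _
    · rw [sum_columnInner_mul_eq_zero hq hq', if_neg hq, if_neg hq']
      simp
  have h4 : ∑ p : Fin n × Fin n, a p.swap ^ 2 = ∑ p, a p ^ 2 :=
    Equiv.sum_comp (Equiv.prodComm _ _) fun p => a p ^ 2
  calc _ ≤ ∑ p, ∑ q, ((if q = p then c * a p ^ 2 else 0)
        + if q = p.swap then c * ((a p ^ 2 + a p.swap ^ 2) / 2) else 0) := by
        rw [h1]
        exact Finset.sum_le_sum fun p _ => Finset.sum_le_sum fun q _ => h2 p q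
    _ = ∑ p, (c * a p ^ 2 + c * ((a p ^ 2 + a p.swap ^ 2) / 2)) := by
        refine Finset.sum_congr rfl fun p _ => ?_
        rw [Finset.sum_add_distrib, Finset.sum_ite_eq' Finset.univ, Finset.sum_ite_eq' Finset.univ]
        simp
    _ = 2 * c * ∑ p, a p ^ 2 := by
        rw [Finset.sum_add_distrib, ← Finset.mul_sum, ← Finset.mul_sum, ← Finset.sum_div,
          Finset.sum_add_distrib, h4]
        ring

lemma sum_sq_inner_sparseMatrix_le {m n : ℕ} (hm : 0 < m) (x y : Vec n) :
    ∑ w : Fin n → Fin m × ℤˣ,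
        (inner ℝ (act (sparseMatrix w) x) (act (sparseMatrix w) y) - inner ℝ x y) ^ 2
      ≤ 2 * (Fintype.card (Fin n → Fin m × ℤˣ) / m) * (‖x‖ ^ 2 * ‖y‖ ^ 2) := by
  simp only [inner_act_sparseMatrix_sub]
  refine (sum_sq_sum_columnInner_le hm fun p => x p.1 * y p.2).trans (le_of_eq ?_)
  rw [EuclideanSpace.real_norm_sq_eq, EuclideanSpace.real_norm_sq_eq, Finset.sum_mul_sum,
    Fintype.sum_prod_type]
  simp only [mul_pow]

/-! ### Sparse sketches are subspace embeddings -/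

instance measurableSingletonClass_units_int : MeasurableSingletonClass ℤˣ :=
  ⟨fun s => ⟨{(s : ℤ)}, trivial, by ext; simp [Units.ext_iff]⟩⟩

/-- The law of the rows and signs of the sparse sketch. -/
noncomputable def sparseLaw (m n : ℕ) : Measure (Fin n → Fin m × ℤˣ) :=
  Measure.pi fun _ : Fin n =>
    (uniformOn (Set.univ : Set (Fin m))).prod (uniformOn (Set.univ : Set ℤˣ))

lemma isProbabilityMeasure_sparseLaw {m : ℕ} (hm : 0 < m) (n : ℕ) :
    IsProbabilityMeasure (sparseLaw m n) := by
  have : Nonempty (Fin m) := ⟨⟨0, hm⟩⟩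
  have h1 : IsProbabilityMeasure (uniformOn (Set.univ : Set (Fin m))) :=
    isProbabilityMeasure_uniformOn Set.finite_univ Set.univ_nonempty
  have h2 : IsProbabilityMeasure (uniformOn (Set.univ : Set ℤˣ)) :=
    isProbabilityMeasure_uniformOn Set.finite_univ Set.univ_nonempty
  unfold sparseLaw
  infer_instance

lemma sparseLaw_real_singleton {m : ℕ} (hm : 0 < m) {n : ℕ} (w : Fin n → Fin m × ℤˣ) :
    (sparseLaw m n).real {w} = (Fintype.card (Fin n → Fin m × ℤˣ) : ℝ)⁻¹ := by
  have : Nonempty (Fin m) := ⟨⟨0, hm⟩⟩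
  have h1 : IsProbabilityMeasure (uniformOn (Set.univ : Set (Fin m))) :=
    isProbabilityMeasure_uniformOn Set.finite_univ Set.univ_nonempty
  have h2 : IsProbabilityMeasure (uniformOn (Set.univ : Set ℤˣ)) :=
    isProbabilityMeasure_uniformOn Set.finite_univ Set.univ_nonempty
  have h3 : ∀ z : Fin m × ℤˣ, ((uniformOn (Set.univ : Set (Fin m))).prod
      (uniformOn (Set.univ : Set ℤˣ))) {z} = (m : ENNReal)⁻¹ * 2⁻¹ := by
    rintro ⟨a, b⟩
    rw [← Set.singleton_prod_singleton, Measure.prod_prod, uniformOn_univ, uniformOn_univ]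
    simp
  rw [measureReal_def, sparseLaw, Measure.pi_singleton]
  simp only [h3, Finset.prod_const, Finset.card_univ, Fintype.card_fin, Fintype.card_fun,
    Fintype.card_prod, Fintype.card_units_int]
  simp [mul_pow, mul_comm]

lemma sparseLaw_markov {m : ℕ} (hm : 0 < m) {n : ℕ} {f : (Fin n → Fin m × ℤˣ) → ℝ}
    (hf : ∀ w, 0 ≤ f w) {a b : ℝ} (ha : 0 < a)
    (hfb : ∑ w, f w ≤ b * Fintype.card (Fin n → Fin m × ℤˣ)) :
    (sparseLaw m n).real {w | a ≤ f w} ≤ b / a := by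
  have := isProbabilityMeasure_sparseLaw hm n
  have h1 := mul_meas_ge_le_integral_of_nonneg (μ := sparseLaw m n) (Eventually.of_forall hf)
    Integrable.of_finite a
  rw [integral_fintype Integrable.of_finite] at h1
  simp only [sparseLaw_real_singleton hm, smul_eq_mul, ← Finset.mul_sum] at h1
  have : Nonempty (Fin m) := ⟨⟨0, hm⟩⟩
  have hcard : (0 : ℝ) < Fintype.card (Fin n → Fin m × ℤˣ) := by
    exact_mod_cast Fintype.card_pos
  rw [le_div_iff₀' ha]
  refine h1.trans ?_
  rw [inv_mul_le_iff₀ hcard]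
  linarith

/-- A bound on the Frobenius norm of the distortion matrix in an orthonormal basis. -/
lemma distortion_le_of_sum_sq_le {E F ι : Type*} [NormedAddCommGroup E] [InnerProductSpace ℝ E]
    [NormedAddCommGroup F] [InnerProductSpace ℝ F] [Fintype ι] (b : OrthonormalBasis ι ℝ E)
    (T : E →ₗ[ℝ] F) {ε : ℝ} (hε : 0 ≤ ε)
    (h : ∑ p : ι × ι, (inner ℝ (T (b p.1)) (T (b p.2)) - inner ℝ (b p.1) (b p.2)) ^ 2 ≤ ε ^ 2)
    (v : E) : |‖T v‖ ^ 2 - ‖v‖ ^ 2| ≤ ε * ‖v‖ ^ 2 := by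
  set c := fun i => inner ℝ (b i) v with hc
  have hv : v = ∑ i, c i • b i := (b.sum_repr' v).symm
  have h1 : ‖T v‖ ^ 2 - ‖v‖ ^ 2 = ∑ p : ι × ι, c p.1 * c p.2
      * (inner ℝ (T (b p.1)) (T (b p.2)) - inner ℝ (b p.1) (b p.2)) := by
    rw [← real_inner_self_eq_norm_sq, ← real_inner_self_eq_norm_sq]
    conv_lhs => rw [hv]
    simp only [map_sum, map_smul, sum_inner, inner_sum, inner_smul_left, inner_smul_right,
      conj_trivial, Fintype.sum_prod_type]
    rw [← Finset.sum_sub_distrib]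
    refine Finset.sum_congr rfl fun i _ => ?_
    rw [← mul_sub, ← Finset.sum_sub_distrib, Finset.mul_sum]
    refine Finset.sum_congr rfl fun k _ => ?_
    rw [real_inner_comm (T (b i)), real_inner_comm (b i)]
    ring
  have h2 : ∑ p : ι × ι, (c p.1 * c p.2) ^ 2 = (‖v‖ ^ 2) ^ 2 := by
    rw [← b.sum_sq_inner_right v, pow_two (∑ i, _), Finset.sum_mul_sum, Fintype.sum_prod_type]
    simp only [mul_pow, hc]
  have h3 := Finset.sum_mul_sq_le_sq_mul_sq Finset.univ (fun p : ι × ι => c p.1 * c p.2)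
    fun p => inner ℝ (T (b p.1)) (T (b p.2)) - inner ℝ (b p.1) (b p.2)
  rw [← h1, h2] at h3
  refine abs_le_of_sq_le_sq ?_ (by positivity)
  calc _ ≤ _ := h3
    _ ≤ (‖v‖ ^ 2) ^ 2 * ε ^ 2 := by gcongr
    _ = _ := by ring

/-- The `r²` pairs of basis vectors contribute at most `2/m` each to the expected squared Frobenius
norm `G`, so Markov at level `ε²` bounds the failure probability by `2r²/(mε²) ≤ δ`. -/
lemma sparseSketch_isSubspaceEmbedding {m n d : ℕ} (X : Mat n d) {ε δ : ℝ} (hε : 0 < ε)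
    (hδ : 0 < δ) (hm0 : 0 < m) (hm : 2 * ((X.rank : ℝ) ^ 2 / δ) / ε ^ 2 ≤ m) :
    WithProbAtLeast (sparseSketch m n) (1 - δ) (IsSubspaceEmbedding ε X) := by
  have hm' : (0 : ℝ) < m := by exact_mod_cast hm0
  have hprob := isProbabilityMeasure_sparseLaw hm0 n
  have hmeas : Measurable (sparseMatrix (m := m) (n := n)) := measurable_of_finite _
  have hlaw : sparseSketch m n = (sparseLaw m n).map sparseMatrix := rfl
  have : IsProbabilityMeasure (sparseSketch m n) := by
    rw [hlaw]
    exact Measure.isProbabilityMeasure_map hmeas.aemeasurable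
  set b := stdOrthonormalBasis ℝ (Matrix.toEuclideanLin X).range
  set G : Mat m n → ℝ := fun P => ∑ p : Fin (Module.finrank ℝ (Matrix.toEuclideanLin X).range) ×
    Fin (Module.finrank ℝ (Matrix.toEuclideanLin X).range),
    (inner ℝ (act P (b p.1 : Vec n)) (act P (b p.2 : Vec n))
      - inner ℝ (b p.1 : Vec n) (b p.2 : Vec n)) ^ 2 with hG
  have hGmeas : Measurable G := Finset.measurable_sum _ fun p _ =>
    ((measurable_inner_act _ _).sub_const _).pow_const 2
  refine withProbAtLeast_of_compl (B := {P | ε ^ 2 ≤ G P})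
    (measurableSet_le measurable_const hGmeas) ?_ ?_
  · rw [hlaw, map_measureReal_apply hmeas (measurableSet_le measurable_const hGmeas)]
    have hsum : ∑ w : Fin n → Fin m × ℤˣ, G (sparseMatrix w)
        ≤ 2 * (X.rank : ℝ) ^ 2 / m * Fintype.card (Fin n → Fin m × ℤˣ) := by
      rw [hG, Finset.sum_comm]
      have hb : ∀ i, ‖(b i : Vec n)‖ = 1 := fun i => b.orthonormal.1 i
      calc _ ≤ ∑ p : Fin (Module.finrank ℝ (Matrix.toEuclideanLin X).range) ×
            Fin (Module.finrank ℝ (Matrix.toEuclideanLin X).range),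
            2 * (Fintype.card (Fin n → Fin m × ℤˣ) / (m : ℝ)) * (1 ^ 2 * 1 ^ 2) := by
            refine Finset.sum_le_sum fun p _ => ?_
            have := sum_sq_inner_sparseMatrix_le hm0 (b p.1 : Vec n) (b p.2 : Vec n)
            rwa [hb, hb] at this
        _ = _ := by
            simp only [Finset.sum_const, Finset.card_univ, Fintype.card_prod, Fintype.card_fin,
              finrank_range_toEuclideanLin, nsmul_eq_mul]
            push_cast
            ring
    refine (sparseLaw_markov hm0 (f := fun w => G (sparseMatrix w))
      (fun w => Finset.sum_nonneg fun _ _ => sq_nonneg _) (by positivity) hsum).trans ?_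
    rw [div_div, div_le_iff₀ (by positivity)]
    rw [div_le_iff₀ (by positivity), ← mul_div_assoc, div_le_iff₀ hδ] at hm
    linarith
  · intro P hP
    rw [isSubspaceEmbedding_iff]
    simp only [Set.mem_ofPred_eq, not_le] at hP
    exact distortion_le_of_sum_sq_le b (rangeAct X P) hε.le hP.le

/-! ### From embeddings to the geometric bound -/

lemma GeometricBound.of_withProbAtLeast {m n d : ℕ} {μ : Measure (Mat m n)} {X : Mat n d}
    {y : Vec n} {h : Vec d → ℝ} {βstar : Vec d} {c ε δ ρ : ℝ}
    (hstar : IsCriticalPoint (objective X y h) βstar) (hc : Regime X h c) (hρ0 : 0 ≤ ρ)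
    (hcε : c < 1 - ε) (hρ : ε / (1 - ε - c) ≤ ρ)
    (hμ : WithProbAtLeast μ (1 - δ) (IsSubspaceEmbedding ε X)) :
    GeometricBound μ X y h βstar δ ρ :=
  hμ.mono fun _ hP N β hβ => run_contraction hc hstar hρ0 hcε hρ hP N β hβ

end SRO

theorem mainTheorem5 :
    ∃ C : ℝ, 0 < C ∧
      ∀ (n d : ℕ) (X : SRO.Mat n d) (y : SRO.Vec n) (h : SRO.Vec d → ℝ) (βstar : SRO.Vec d)
        (c δ ρ : ℝ),
        SRO.IsCriticalPoint (SRO.objective X y h) βstar →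
        SRO.Regime X h c → 0 < δ → δ < 1 → 0 < ρ →
        -- a sketch drawn from an arbitrary oblivious subspace embedding
        (∀ (m : ℕ) (ε : ℝ) (μ : MeasureTheory.Measure (SRO.Mat m n)),
          0 < ε → ε < 1 → c < 1 - ε → ε / (1 - ε - c) ≤ ρ →
          SRO.IsObliviousSubspaceEmbedding d ε δ μ →
          SRO.GeometricBound μ X y h βstar δ ρ) ∧
        -- sufficient sketch sizes for a given contraction factor
        (ρ < 1 → c < 1 →
          (∀ m : ℕ,
            C * (((X.rank : ℝ) + Real.log (1 / δ)) * (ρ + 1) ^ 2 / ((1 - c) ^ 2 * ρ ^ 2)) ≤ m →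
            SRO.GeometricBound (SRO.gaussianSketch m n) X y h βstar δ ρ) ∧
          (∀ m : ℕ, 0 < m →
            C * ((X.rank : ℝ) ^ 2 / δ * (ρ + 1) ^ 2 / ((1 - c) ^ 2 * ρ ^ 2)) ≤ m →
            SRO.GeometricBound (SRO.sparseSketch m n) X y h βstar δ ρ)) := by
  -- The Gaussian sketch dictates 1000; the sparse one needs only 2.
  refine ⟨1000, by norm_num, fun n d X y h βstar c δ ρ hstar hc hδ0 hδ1 hρ0 => ⟨?_, ?_⟩⟩
  · intro m ε μ _ _ hcε hρ hμ
    exact SRO.GeometricBound.of_withProbAtLeast hstar hc hρ0.le hcε hρ (hμ.2 X)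
  intro hρ1 hc1
  have hc0 := hc.nonneg
  have h1c : 0 < 1 - c := by linarith
  -- This `ε` solves `ε / (1 - ε - c) = ρ`, as `1 - ε - c = (1 - c)/(ρ + 1)`.
  obtain ⟨ε, hε⟩ : ∃ ε, ε = (1 - c) * (ρ / (ρ + 1)) := ⟨_, rfl⟩
  have hε0 : 0 < ε := by rw [hε]; positivity
  have hlt : ρ / (ρ + 1) < 1 := by rw [div_lt_one (by positivity)]; linarith
  have hεc : ε < 1 - c := by rw [hε]; nlinarith
  have hρε : ε / (1 - ε - c) ≤ ρ := by
    rw [div_le_iff₀ (by linarith), hε]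
    apply le_of_eq
    field_simp
    ring
  have hsize : ∀ a : ℝ, a * (ρ + 1) ^ 2 / ((1 - c) ^ 2 * ρ ^ 2) = a / ε ^ 2 := by
    intro a
    rw [hε]
    field_simp
  refine ⟨fun m hm => ?_, fun m hm0 hm => ?_⟩
  · rw [hsize, ← mul_div_assoc] at hm
    exact SRO.GeometricBound.of_withProbAtLeast hstar hc hρ0.le (by linarith) hρε
      (SRO.gaussianSketch_isSubspaceEmbedding X hε0 (by linarith) hδ0 hδ1 hm)
  · rw [hsize] at hm
    refine SRO.GeometricBound.of_withProbAtLeast hstar hc hρ0.le (by linarith) hρε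
      (SRO.sparseSketch_isSubspaceEmbedding X hε0 hδ0 hm0 (le_trans ?_ hm))
    rw [mul_div_assoc]
    gcongr
    norm_num
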